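/- **Model.** Fix an integer $B>1$ (battery capacity), $\lambda\in[0,1]$ (energy arrival probability), $p\in(0,1)$ (channel erasure probability), $C_r\ge 0$ (cost of one update paid from the backup supply) and $\omega>0$ (weight). The state is $(\Delta,q)\in\mathbb Z^+\times\{0,\dots,B\}$ ($\Delta$ is the age of information, $q$ the battery level); the action is $a=0$ (idle) or $a=1$ (generate and transmit an update). Given $(\Delta,q)$ and $a$, draw independently an energy arrival $b\in\{0,1\}$ with $\Pr(b=1)=\lambda$ and an erasure of probability $p$. The next battery level is $\min\{q+b-a\,u(q),B\}$, where $u(x)=1$ for $x>0$ and $u(0)=0$; the next age is $1$ if $a=1$ and the update is not erased, and $\Delta+1$ otherwise. The one-step cost is $C(\Delta,q,a)=\Delta+\omega C_r\,a\,(1-u(q))$. The average cost of a policy is $\limsup_{T\to\infty}\frac1T\,\mathbb E\sum_{t=0}^{T-1}C(\Delta[t],q[t],a[t])$, and a stationary deterministic policy is optimal if, from every initial state, its average cost is at most that of every non-anticipative (possibly randomized and history-dependent) policy. For $V:\mathbb Z^+\times\{0,\dots,B\}\to\mathbb R$ put $Q(x,a)=C(x,a)+\sum_{x'}\Pr(x'\mid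 x,a)V(x')$. Call $V$ a relative value function with gain $g\in\mathbb R$ if $g+V(x)=\min_{a\in\{0,1\}}Q(x,a)$ for all states $x$ and $V$ is bounded below and of at most polynomial growth in $\Delta$. **Theorem.** A relative value function exists. Let $V$ be any relative value function, with gain $g$. Then: 1. $g$ is the minimal (infimal) average cost over all non-anticipative policies, from every initial state. 2. Every stationary deterministic policy $\pi^\star$ with $\pi^\star(x)\in\arg\min_a Q(x,a)$ for all $x$ is optimal, and for every battery level $q$ there is a threshold $\Delta_q\in\mathbb Z^+$ such that $\pi^\star(\Delta,q)=0$ for $\Delta<\Delta_q$ and $\pi^\star(\Delta,q)=1$ for $\Delta\ge\Delta_q$. 3. $Q$ is submodular in $(\Delta,a)$: $Q(\Delta,q,0)-Q(\Delta,q,1)\le Q(\Delta+1,q,0)-Q(\Delta+1,q,1)$ for all $\Delta\ge 1$ and $0\le q\le B$. 4. $V(\Delta_1,q)\le V(\Delta_2,q)$ and $V(\Delta_2,q)-V(\Delta_1,q)\ge\Delta_2-\Delta_1$ for all $1\le\Delta_1\le\Delta_2$ and $0\le q\le B$. 5. If $\lambda<1$, then $V(\Delta,q)\ge V(\Delta,q+1)$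 for all $\Delta\ge1$ and $0\le q<B$. 6. $V(\Delta+1,q+1)-V(\Delta,q+1)\ge p\,[V(\Delta+1,q)-V(\Delta,q)]$ for all $\Delta\ge1$ and $0\le q<B$. -/

import Mathlib

open Filter
open scoped ENNReal

noncomputable section

/-- The parameters of the update system: battery capacity `B`, energy arrival probability `lam`,
erasure probability `p`, cost `Cr` of one update paid from the backup supply, weight `w`. -/
structure UpdateSystem where
  B : ℕ
  lam : ℝ
  p : ℝ
  Cr : ℝ
  w : ℝ
  one_lt_B : 1 < B
  lam_nonneg : 0 ≤ lam
  lam_le_one : lam ≤ 1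
  p_pos : 0 < p
  p_lt_one : p < 1
  Cr_nonneg : 0 ≤ Cr
  w_pos : 0 < w

/-- The law of a `{true, false}`-valued random variable which is `true` with probability `r`. -/
def coin (r : ℝ) (h0 : 0 ≤ r) (h1 : r ≤ 1) : PMF Bool :=
  PMF.ofFintype (fun b => if b then ENNReal.ofReal r else ENNReal.ofReal (1 - r)) (by
    rw [Fintype.sum_bool]
    simp only [if_true, Bool.false_eq_true, if_false]
    rw [← ENNReal.ofReal_add h0 (sub_nonneg.mpr h1)]
    simp)

namespace UpdateSystem

/-- A state is a pair (age of information, battery level), with age in `{1, 2, …}` and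
battery level in `{0, …, B}`. -/
abbrev State (S : UpdateSystem) : Type := ℕ+ × Fin (S.B + 1)

/-- Action `0`: stay idle. Action `1`: generate and transmit an update. -/
abbrev Action : Type := Fin 2

/-- The unit step function on battery levels. -/
def step (q : ℕ) : ℕ := if 0 < q then 1 else 0

/-- The next age: `1` after a successful transmission, otherwise the age grows by one. -/
def nextAge (d : ℕ+) (a : Action) (erased : Bool) : ℕ+ :=
  if a = 1 ∧ erased = false then 1 else d + 1

/-- The next battery level `min (q + b - a u(q)) B`, where `b` is `1` if a unit of energy arrives
and `0` otherwise. The subtraction never truncates, because `u(q) ≤ q`. -/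
def nextBattery (S : UpdateSystem) (q : Fin (S.B + 1)) (a : Action) (arrival : Bool) :
    Fin (S.B + 1) :=
  ⟨min ((q : ℕ) + (if arrival then 1 else 0) - (a : ℕ) * step q) S.B,
    Nat.lt_succ_of_le (min_le_right _ _)⟩

/-- The transition law: energy arrival and erasure are independent coins. -/
def transition (S : UpdateSystem) (x : S.State) (a : Action) : PMF S.State :=
  (coin S.lam S.lam_nonneg S.lam_le_one).bind fun arrival =>
    (coin S.p S.p_pos.le S.p_lt_one.le).bind fun erased =>
      PMF.pure (nextAge x.1 a erased, S.nextBattery x.2 a arrival)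

/-- The one-step cost: age plus weighted cost of the backup energy. -/
def cost (S : UpdateSystem) (x : S.State) (a : Action) : ℝ :=
  ((x.1 : ℕ) : ℝ) + S.w * S.Cr * ((a : ℕ) : ℝ) * (1 - ((step x.2 : ℕ) : ℝ))

/-- A non-anticipative policy, possibly randomized and history dependent: the law of the action,
given the list of past (state, action) pairs (oldest first) and the current state. -/
abbrev Policy (S : UpdateSystem) : Type := List (S.State × Action) → S.State → PMF Action

/-- A stationary deterministic policy. -/
abbrev Stationary (S : UpdateSystem) : Type := S.State → Action

/-- A stationary deterministic policy, seen as a policy. -/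
def Stationary.toPolicy {S : UpdateSystem} (π : S.Stationary) : S.Policy :=
  fun _ x => PMF.pure (π x)

/-- The joint law of the history before slot `t` and the state in slot `t`, under the policy `π`,
when the state in slot `0` is `x₀`. -/
def law (S : UpdateSystem) (π : S.Policy) (x₀ : S.State) :
    ℕ → PMF (List (S.State × Action) × S.State)
  | 0 => PMF.pure ([], x₀)
  | t + 1 => (law S π x₀ t).bind fun y =>
      (π y.1 y.2).bind fun a =>
        (S.transition y.2 a).bind fun x' => PMF.pure (y.1 ++ [(y.2, a)], x')

/-- The expected cost in slot `t`. Costs are nonnegative, so that it always exists in `[0, ∞]`. -/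
def expectedCost (S : UpdateSystem) (π : S.Policy) (x₀ : S.State) (t : ℕ) : ℝ≥0∞ :=
  ∑' y : List (S.State × Action) × S.State, S.law π x₀ t y *
    ∑' a : Action, π y.1 y.2 a * ENNReal.ofReal (S.cost y.2 a)

/-- The long-run average cost: the upper limit of the expected averages over `T` slots. -/
def avgCost (S : UpdateSystem) (π : S.Policy) (x₀ : S.State) : ℝ≥0∞ :=
  limsup (fun T : ℕ => (∑ t ∈ Finset.range T, S.expectedCost π x₀ t) / (T : ℝ≥0∞)) atTop

/-- A stationary deterministic policy is average-cost optimal if from every initial state no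
non-anticipative policy has a smaller long-run average cost. -/
def IsOptimal (S : UpdateSystem) (π : S.Stationary) : Prop :=
  ∀ (x₀ : S.State) (σ : S.Policy), S.avgCost π.toPolicy x₀ ≤ S.avgCost σ x₀

/-- The state-action value function of `V`. The sum has at most four nonzero terms. -/
def Q (S : UpdateSystem) (V : S.State → ℝ) (x : S.State) (a : Action) : ℝ :=
  S.cost x a + ∑' x' : S.State, (S.transition x a x').toReal * V x'

/-- `V` is a relative value function with gain `g`: it solves the average-cost Bellman equation,
is bounded below, and grows at most polynomially with the age. (Without the last two conditions the
Bellman equation has spurious solutions, which have nothing to do with the control problem.) -/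
structure IsRelativeValue (S : UpdateSystem) (g : ℝ) (V : S.State → ℝ) : Prop where
  bellman : ∀ x, g + V x = min (S.Q V x 0) (S.Q V x 1)
  bddBelow : BddBelow (Set.range V)
  growth : ∃ (K : ℝ) (m : ℕ), ∀ x : S.State, V x ≤ K * ((x.1 : ℕ) : ℝ) ^ m

/-- `π` selects in every state a minimizer of the state-action value function. -/
def IsGreedy (S : UpdateSystem) (V : S.State → ℝ) (π : S.Stationary) : Prop :=
  ∀ x a, S.Q V x (π x) ≤ S.Q V x a

end UpdateSystem

end

/-! The structural claims are extracted from the average-cost Bellman equation itself, so they hold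
for every relative value function and not just for one built by value iteration. Transmitting
multiplies the weight of the aged continuation by `p < 1`. Hence an inequality that reproduces
itself with factor `p` when the age grows by one, for quantities of polynomial growth, can be
iterated to infinity (`nonpos_of_contracting`). This pins any solution between two lines of slope
`(1 - p)⁻¹`, makes transmission strictly better at all large ages, and forces the age increments
there to equal `(1 - p)⁻¹` exactly (`exists_increment_eq`). From that region, backward induction in
the age (`increment_step`) carries down two facts: increments are at least `1`, and one more battery
unit shrinks an increment by no more than the factor `p`. Together they make the advantage of
transmitting grow by at least `1 - p` per unit of age. The strict growth makes every greedy policy a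
threshold policy, however ties are broken. Monotonicity in the battery is a minimum principle
(`battery_antitone`).

Existence is by vanishing discount: discounted value functions, normalized at the best age with an
empty battery, obey bounds independent of the discount factor (`IsTame`), and an ultrafilter limit
solves the undiscounted equation.

Optimality is by telescoping the Bellman inequality. The terminal term need not be shown negligible:
the value is at most a constant times the current cost, and a policy whose last cost keeps
compensating a deficit linear in time has quadratically growing total cost (`not_running_sum_le`).
-/

/-! ### Convex combinations and contraction along the age. -/

theorem mix_le {r x y M : ℝ} (h0 : 0 ≤ r) (h1 : r ≤ 1) (hx : x ≤ M) (hy : y ≤ M) :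
    r * x + (1 - r) * y ≤ M := by
  nlinarith [mul_le_mul_of_nonneg_left hx h0, mul_le_mul_of_nonneg_left hy (sub_nonneg.2 h1)]

theorem le_mix {r x y M : ℝ} (h0 : 0 ≤ r) (h1 : r ≤ 1) (hx : M ≤ x) (hy : M ≤ y) :
    M ≤ r * x + (1 - r) * y := by
  nlinarith [mul_le_mul_of_nonneg_left hx h0, mul_le_mul_of_nonneg_left hy (sub_nonneg.2 h1)]

theorem mix_mono {r x y x' y' : ℝ} (h0 : 0 ≤ r) (h1 : r ≤ 1) (hx : x ≤ x') (hy : y ≤ y') :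
    r * x + (1 - r) * y ≤ r * x' + (1 - r) * y' :=
  add_le_add (mul_le_mul_of_nonneg_left hx h0) (mul_le_mul_of_nonneg_left hy (sub_nonneg.2 h1))

/-- A family that contracts by a factor `p < 1` at each shift and grows polynomially is
nonpositive. -/
theorem nonpos_of_contracting {ι : Type*} {p : ℝ} (hp0 : 0 < p) (hp1 : p < 1) (f : ℕ → ι → ℝ)
    (hf : ∀ d M, (∀ j, f (d + 1) j ≤ M) → ∀ i, f d i ≤ p * M)
    {K : ℝ} {m : ℕ} (hK : ∀ d i, f d i ≤ K * ((d : ℝ) + 1) ^ m) (d : ℕ) (i : ι) : f d i ≤ 0 := by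
  have key : ∀ (n d : ℕ) (i : ι), f d i ≤ p ^ n * (K * ((d : ℝ) + n + 1) ^ m) := by
    intro n
    induction n with
    | zero => intro d i; simpa using hK d i
    | succ n ih =>
      intro d i
      have := hf d _ (fun j => ih (d + 1) j) i
      refine this.trans (le_of_eq ?_)
      push_cast
      ring
  have h1 := tendsto_pow_const_mul_const_pow_of_abs_lt_one m (r := p)
    (by rw [abs_of_pos hp0]; exact hp1)
  -- With `N = n + d + 1`, the bound in `key` is `K * p⁻⁽ᵈ⁺¹⁾ * (N ^ m * p ^ N)`, so geometric decay
  -- beats the polynomial.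
  have h2 := ((tendsto_add_atTop_iff_nat (d + 1)).2 h1).const_mul (K * (p ^ (d + 1))⁻¹)
  rw [mul_zero] at h2
  refine ge_of_tendsto' h2 fun n => (key n d i).trans (le_of_eq ?_)
  have : p ^ (d + 1) ≠ 0 := by positivity
  rw [pow_add p n (d + 1)]
  push_cast
  field_simp
  ring

/-! ### Structure of arbitrary solutions of the average-cost equation. -/

namespace UpdateSystem

noncomputable section

/-- The price of an update in a slot that starts with battery level `q`. -/
def fee (S : UpdateSystem) (q : ℕ) : ℝ := if q = 0 then S.w * S.Cr else 0

/-- The mean of `v` over an erasure, at the battery level `q`. -/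
def relay (S : UpdateSystem) (v : ℕ → ℕ → ℝ) (d q : ℕ) : ℝ :=
  S.p * v (d + 1) q + (1 - S.p) * v 0 q

/-- The `β`-discounted value of idling at age `d + 1` with battery level `q`. -/
def idleValue (S : UpdateSystem) (β : ℝ) (v : ℕ → ℕ → ℝ) (d q : ℕ) : ℝ :=
  (d : ℝ) + 1 + β * (S.lam * v (d + 1) (q + 1) + (1 - S.lam) * v (d + 1) q)

/-- The `β`-discounted value of transmitting at age `d + 1` with battery level `q`. -/
def sendValue (S : UpdateSystem) (β : ℝ) (v : ℕ → ℕ → ℝ) (d q : ℕ) : ℝ :=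
  (d : ℝ) + 1 + S.fee q +
    β * (S.lam * S.relay v d (max q 1) + (1 - S.lam) * S.relay v d (q - 1))

/-- Relative value functions in coordinates: `v d q` is the value at age `d + 1` and battery level
`min q B`. -/
structure IsAgeSolution (S : UpdateSystem) (g : ℝ) (v : ℕ → ℕ → ℝ) : Prop where
  bellman : ∀ d q, q ≤ S.B → g + v d q = min (S.idleValue 1 v d q) (S.sendValue 1 v d q)
  saturated : ∀ d q, S.B ≤ q → v d q = v d S.B
  bddBelow : ∃ k, ∀ d q, -k ≤ v d q
  growth : ∃ (K : ℝ) (m : ℕ), ∀ d q, v d q ≤ K * ((d : ℝ) + 1) ^ m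

variable {S : UpdateSystem}

theorem updateCost_nonneg : 0 ≤ S.w * S.Cr := mul_nonneg S.w_pos.le S.Cr_nonneg

theorem fee_nonneg (q : ℕ) : 0 ≤ S.fee q := by
  unfold fee; split_ifs
  exacts [updateCost_nonneg, le_rfl]

theorem fee_le (q : ℕ) : S.fee q ≤ S.w * S.Cr := by
  unfold fee; split_ifs
  exacts [le_rfl, updateCost_nonneg]

@[simp] theorem fee_zero : S.fee 0 = S.w * S.Cr := by simp [fee]

@[simp] theorem fee_succ (q : ℕ) : S.fee (q + 1) = 0 := by simp [fee]

@[simp] theorem max_succ_one (q : ℕ) : max (q + 1) 1 = q + 1 := by omega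

/-- The line `a * (d + 1) + H` with `a = 1 + p * a` and `H = A + p * a + p * H` satisfies the
hypothesis with equality, so the excess of `v` over it contracts by `p`. -/
theorem linear_le_of_subsolution {v : ℕ → ℕ → ℝ} {A : ℝ} {K : ℝ} {m : ℕ}
    (hv : ∀ d q M, (∀ j, v (d + 1) j ≤ M) → v d q ≤ (d : ℝ) + 1 + A + S.p * M)
    (hK : ∀ d q, v d q ≤ K * ((d : ℝ) + 1) ^ m) :
    ∃ H, ∀ d q : ℕ, v d q ≤ (1 - S.p)⁻¹ * ((d : ℝ) + 1) + H := by
  have hp := S.p_lt_one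
  have hp0 := S.p_pos
  have h1p : (1 - S.p) ≠ 0 := by linarith
  have hpos : 0 < (1 - S.p)⁻¹ := by rw [inv_pos]; linarith
  set a := (1 - S.p)⁻¹ with ha
  have ha' : a = 1 + S.p * a := by rw [ha]; field_simp; ring
  obtain ⟨H, hH⟩ : ∃ H, H = A + S.p * a + S.p * H := ⟨a * (A + S.p * a), by
    linear_combination (A + S.p * a) * ha'⟩
  refine ⟨H, fun d q => ?_⟩
  have := nonpos_of_contracting hp0 hp (fun d q => v d q - (a * ((d : ℝ) + 1) + H))
    (K := |K| + |H|) (m := m) ?_ ?_ d q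
  · linarith
  · intro d M hM q
    have h := hv d q (M + (a * ((d : ℝ) + 2) + H)) (fun j => by
      have := hM j; push_cast at this; linarith)
    have e1 : a * ((d : ℝ) + 1) = ((d : ℝ) + 1) + S.p * a * ((d : ℝ) + 1) := by
      linear_combination ((d : ℝ) + 1) * ha'
    nlinarith
  · intro d q
    have h1 : (1 : ℝ) ≤ ((d : ℝ) + 1) ^ m := one_le_pow₀ (by linarith [Nat.cast_nonneg (α := ℝ) d])
    have h2 : 0 ≤ a * ((d : ℝ) + 1) := by positivity
    have h3 := hK d q
    have h4 : K * ((d : ℝ) + 1) ^ m ≤ |K| * ((d : ℝ) + 1) ^ m :=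
      mul_le_mul_of_nonneg_right (le_abs_self K) (by positivity)
    have h5 : |H| * 1 ≤ |H| * ((d : ℝ) + 1) ^ m := mul_le_mul_of_nonneg_left h1 (abs_nonneg H)
    have h6 := neg_abs_le H
    nlinarith

namespace IsAgeSolution

variable {g : ℝ} {v : ℕ → ℕ → ℝ}

/-- Statements about all battery levels need checking only up to the capacity. -/
theorem forall_of_le (hv : S.IsAgeSolution g v) {P : ℕ → ℝ → Prop} {d : ℕ}
    (h : ∀ q ≤ S.B, P d (v d q)) (q : ℕ) : P d (v d q) := by
  rcases le_total q S.B with hq | hq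
  · exact h q hq
  · rw [hv.saturated d q hq]; exact h _ le_rfl

/-- Always transmitting is one of the two options in the minimum. Its success branch is bounded by
`K`, the growth bound at `d = 0`. -/
theorem exists_upper (hv : S.IsAgeSolution g v) :
    ∃ H, ∀ d q : ℕ, v d q ≤ (1 - S.p)⁻¹ * ((d : ℝ) + 1) + H := by
  obtain ⟨K, m, hK⟩ := hv.growth
  refine linear_le_of_subsolution (A := S.w * S.Cr - g + (1 - S.p) * K) ?_ hK
  intro d q M hM
  revert q
  refine fun q => hv.forall_of_le (P := fun d x => x ≤ (d : ℝ) + 1 + _ + _) (fun q hq => ?_) q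
  have h0 : ∀ q, v 0 q ≤ K := fun q => by simpa using hK 0 q
  have hr : ∀ q, S.relay v d q ≤ S.p * M + (1 - S.p) * K := fun q =>
    mix_mono S.p_pos.le S.p_lt_one.le (hM q) (h0 q)
  have hb := (hv.bellman d q hq).le.trans (min_le_right _ _)
  unfold sendValue at hb
  have := mix_le S.lam_nonneg S.lam_le_one (hr (max q 1)) (hr (q - 1))
  have := S.fee_le q
  linarith

theorem exists_lower (hv : S.IsAgeSolution g v) :
    ∃ H, ∀ d q : ℕ, (1 - S.p)⁻¹ * ((d : ℝ) + 1) - H ≤ v d q := by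
  obtain ⟨k, hk⟩ := hv.bddBelow
  have hp := S.p_lt_one
  have hp0 := S.p_pos
  have h1p : (1 - S.p) ≠ 0 := by linarith
  have hpos : 0 < (1 - S.p)⁻¹ := by rw [inv_pos]; linarith
  set a := (1 - S.p)⁻¹ with ha
  have ha' : a = 1 + S.p * a := by rw [ha]; field_simp; ring
  set A := g + (1 - S.p) * k
  obtain ⟨H, hH⟩ : ∃ H, H = A - S.p * a + S.p * H := ⟨a * (A - S.p * a), by
    linear_combination (A - S.p * a) * ha'⟩
  refine ⟨H, fun d q => ?_⟩
  have := nonpos_of_contracting hp0 hp (fun d q => a * ((d : ℝ) + 1) - H - v d q)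
    (K := a + |H| + |k|) (m := 1) ?_ ?_ d q
  · linarith
  · intro d M hM q
    refine hv.forall_of_le (P := fun d x => _ - H - x ≤ _) (fun q hq => ?_) q
    have hM' : ∀ q, a * ((d : ℝ) + 2) - H - M ≤ v (d + 1) q := fun q => by
      have := hM q; push_cast at this; linarith
    set L := a * ((d : ℝ) + 2) - H - M with hL
    have hr : ∀ q, S.p * L + (1 - S.p) * (-k) ≤ S.relay v d q := fun q =>
      mix_mono hp0.le hp.le (hM' q) (hk 0 q)
    -- Idling has no factor `p` of its own. Mixing the bound `L` with the global bound `-k` gives it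
    -- the same lower estimate as transmitting.
    have hi : ∀ q, S.p * L + (1 - S.p) * (-k) ≤ v (d + 1) q := fun q => by
      have h1 := mul_le_mul_of_nonneg_left (hM' q) hp0.le
      have h2 := mul_le_mul_of_nonneg_left (hk (d + 1) q) (sub_nonneg.2 hp.le)
      linarith
    have hb : (d : ℝ) + 1 + (S.p * L + (1 - S.p) * (-k)) ≤ g + v d q := by
      rw [hv.bellman d q hq]
      refine le_min ?_ ?_
      · have := le_mix S.lam_nonneg S.lam_le_one (hi (q + 1)) (hi q)
        unfold idleValue; linarith
      · have := le_mix S.lam_nonneg S.lam_le_one (hr (max q 1)) (hr (q - 1))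
        have := S.fee_nonneg q
        unfold sendValue; linarith
    have e1 : a * ((d : ℝ) + 1) = ((d : ℝ) + 1) + S.p * a * ((d : ℝ) + 1) := by
      linear_combination ((d : ℝ) + 1) * ha'
    rw [hL] at hb
    nlinarith
  · intro d q
    have h1 : (1 : ℝ) ≤ (d : ℝ) + 1 := by linarith [Nat.cast_nonneg (α := ℝ) d]
    have h3 := hk d q
    have h4 := mul_le_mul_of_nonneg_left h1 (abs_nonneg H)
    have h5 := mul_le_mul_of_nonneg_left h1 (abs_nonneg k)
    have h6 := neg_abs_le H
    have h7 := le_abs_self k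
    simp only [pow_one]
    nlinarith

/-- At large ages transmitting is strictly better than idling. -/
theorem exists_send_lt_idle (hv : S.IsAgeSolution g v) :
    ∃ D, ∀ d ≥ D, ∀ q, S.sendValue 1 v d q < S.idleValue 1 v d q := by
  obtain ⟨H, hH⟩ := hv.exists_upper
  obtain ⟨H', hH'⟩ := hv.exists_lower
  have hp := S.p_lt_one
  have hp0 := S.p_pos
  have h1p : (1 - S.p) ≠ 0 := by linarith
  have hpos : 0 < (1 - S.p)⁻¹ := by rw [inv_pos]; linarith
  set a := (1 - S.p)⁻¹ with ha
  have ha' : a = 1 + S.p * a := by rw [ha]; field_simp; ring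
  obtain ⟨D, hD⟩ := exists_nat_gt (H + H' + S.w * S.Cr + a)
  refine ⟨D, fun d hd q => ?_⟩
  have hd' : (D : ℝ) ≤ d := by exact_mod_cast hd
  have hr : ∀ q, S.relay v d q ≤ S.p * (a * ((d : ℝ) + 2) + H) + (1 - S.p) * (a + H) := fun q =>
    mix_mono hp0.le hp.le (by have := hH (d + 1) q; push_cast at this; linarith)
      (by simpa using hH 0 q)
  have hi : ∀ q, a * ((d : ℝ) + 2) - H' ≤ v (d + 1) q := fun q => by
    have := hH' (d + 1) q; push_cast at this; linarith
  have h1 := mix_le S.lam_nonneg S.lam_le_one (hr (max q 1)) (hr (q - 1))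
  have h2 := le_mix S.lam_nonneg S.lam_le_one (hi (q + 1)) (hi q)
  have := S.fee_le q
  have e1 : a * ((d : ℝ) + 2) = ((d : ℝ) + 2) + S.p * a * ((d : ℝ) + 2) := by
    linear_combination ((d : ℝ) + 2) * ha'
  have : 0 ≤ S.p * a := by positivity
  unfold sendValue idleValue
  nlinarith

/-- Where transmission is optimal the success branches cancel from the increments, which therefore
satisfy `x = 1 + p * (average of later x)`. Their deviation from the fixed point `(1 - p)⁻¹` is
bounded, because the upper and lower lines are parallel, and contracts by `p`. -/
theorem exists_increment_eq (hv : S.IsAgeSolution g v) :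
    ∃ D, (∀ d ≥ D, ∀ q, S.sendValue 1 v d q < S.idleValue 1 v d q) ∧
      ∀ d ≥ D, ∀ q, v (d + 1) q - v d q = (1 - S.p)⁻¹ := by
  obtain ⟨D, hD⟩ := hv.exists_send_lt_idle
  obtain ⟨H, hH⟩ := hv.exists_upper
  obtain ⟨H', hH'⟩ := hv.exists_lower
  have hp := S.p_lt_one
  have hp0 := S.p_pos
  have h1p : (1 - S.p) ≠ 0 := by linarith
  have hpos : 0 < (1 - S.p)⁻¹ := by rw [inv_pos]; linarith
  set a := (1 - S.p)⁻¹ with ha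
  have ha' : a = 1 + S.p * a := by rw [ha]; field_simp; ring
  refine ⟨D, hD, ?_⟩
  have hrec : ∀ d ≥ D, ∀ q ≤ S.B, v (d + 1) q - v d q = 1 + S.p *
      (S.lam * (v (d + 2) (max q 1) - v (d + 1) (max q 1)) +
        (1 - S.lam) * (v (d + 2) (q - 1) - v (d + 1) (q - 1))) := by
    intro d hd q hq
    have h1 := hv.bellman d q hq
    have h2 := hv.bellman (d + 1) q hq
    rw [min_eq_right (hD d hd q).le] at h1
    rw [min_eq_right (hD (d + 1) (by omega) q).le] at h2
    unfold sendValue relay at h1 h2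
    push_cast at h2
    linear_combination h2 - h1
  have bound : ∀ d q, |v (d + 1) q - v d q - a| ≤ |H| + |H'| := by
    intro d q
    have h1 := hH d q
    have h2 := hH (d + 1) q
    have h3 := hH' d q
    have h4 := hH' (d + 1) q
    push_cast at h2 h4
    rw [abs_le]
    constructor <;> linarith [le_abs_self H, le_abs_self H']
  have clamp : ∀ d q, v (d + 1) q - v d q = v (d + 1) (min q S.B) - v d (min q S.B) := by
    intro d q
    rcases le_total q S.B with h | h
    · rw [min_eq_left h]
    · rw [min_eq_right h, hv.saturated _ _ h, hv.saturated _ _ h]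
  -- The contraction lemma is one-sided; `s = 1` and `s = -1` together give equality.
  have side : ∀ s : ℝ, |s| = 1 → ∀ d q, s * (v (D + d + 1) q - v (D + d) q - a) ≤ 0 := by
    intro s hs
    refine nonpos_of_contracting hp0 hp
      (fun d q => s * (v (D + d + 1) q - v (D + d) q - a)) (K := |H| + |H'|) (m := 0) ?_ ?_
    · intro d M hM q
      rw [clamp, hrec (D + d) (by omega) _ (min_le_right _ _)]
      have h := mix_le S.lam_nonneg S.lam_le_one (hM (max (min q S.B) 1)) (hM (min q S.B - 1))
      rw [← add_assoc] at h
      have h' := mul_le_mul_of_nonneg_left h hp0.le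
      rw [show D + d + 1 + 1 = D + d + 2 from rfl] at h'
      have e : s * a = s + S.p * s * a := by linear_combination s * ha'
      linarith
    · intro d q
      have := bound (D + d) q
      simp only [pow_zero, mul_one]
      refine (le_abs_self _).trans ?_
      rw [abs_mul, hs, one_mul]
      exact this
  intro d hd q
  obtain ⟨n, rfl⟩ := Nat.exists_eq_add_of_le hd
  have h1 := side 1 (by simp) n q
  have h2 := side (-1) (by simp) n q
  linarith

/-- The backward induction step. The summand `1 - p` in `h2` is what makes the resulting
submodularity strict. With an empty battery `h1` alone suffices, since then both actions lead to the
same battery levels. -/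
theorem increment_step (hv : S.IsAgeSolution g v) {d : ℕ}
    (h1 : ∀ q, 1 ≤ v (d + 2) q - v (d + 1) q)
    (h2 : ∀ q, S.p * (v (d + 2) q - v (d + 1) q) + (1 - S.p) ≤
      v (d + 2) (q + 1) - v (d + 1) (q + 1)) :
    (∀ q, 1 ≤ v (d + 1) q - v d q) ∧
    (∀ q, S.p * (v (d + 1) q - v d q) + (1 - S.p) ≤ v (d + 1) (q + 1) - v d (q + 1)) ∧
    (∀ q, (S.idleValue 1 v d q - S.sendValue 1 v d q) + (1 - S.p) ≤
      S.idleValue 1 v (d + 1) q - S.sendValue 1 v (d + 1) q) := by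
  have hp := S.p_lt_one
  have hp0 := S.p_pos
  have hl := S.lam_nonneg
  have hl1 := S.lam_le_one
  have sub : ∀ q, (S.idleValue 1 v d q - S.sendValue 1 v d q) + (1 - S.p) ≤
      S.idleValue 1 v (d + 1) q - S.sendValue 1 v (d + 1) q := by
    intro q
    unfold idleValue sendValue relay
    push_cast
    cases q with
    | zero =>
      have h := le_mix hl hl1 (h1 1) (h1 0)
      have h' := mul_le_mul_of_nonneg_left h (sub_nonneg.2 hp.le)
      simp only [zero_add, Nat.zero_sub, zero_le, sup_of_le_right]
      linarith
    | succ q =>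
      have h := le_mix hl hl1
        (x := v (d + 2) (q + 2) - v (d + 1) (q + 2) - S.p * (v (d + 2) (q + 1) - v (d + 1) (q + 1)))
        (y := v (d + 2) (q + 1) - v (d + 1) (q + 1) - S.p * (v (d + 2) q - v (d + 1) q))
        (M := 1 - S.p) (by linarith [h2 (q + 1)]) (by linarith [h2 q])
      simp only [max_succ_one, Nat.add_sub_cancel]
      rw [show q + 1 + 1 = q + 2 from rfl, show d + 1 + 1 = d + 2 from rfl]
      linarith
  -- Since idling loses ground to transmitting as the age grows, the increment of the minimum lies
  -- between the increments of the two options.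
  have lower : ∀ q ≤ S.B, S.sendValue 1 v (d + 1) q - S.sendValue 1 v d q ≤ v (d + 1) q - v d q := by
    intro q hq
    have e1 := hv.bellman d q hq
    have e2 := hv.bellman (d + 1) q hq
    have e3 := min_le_left (S.idleValue 1 v d q) (S.sendValue 1 v d q)
    have e4 := min_le_right (S.idleValue 1 v d q) (S.sendValue 1 v d q)
    have := sub q
    rcases min_choice (S.idleValue 1 v (d + 1) q) (S.sendValue 1 v (d + 1) q) with h | h <;>
      rw [h] at e2 <;> linarith
  have upper : ∀ q ≤ S.B, v (d + 1) q - v d q ≤ S.idleValue 1 v (d + 1) q - S.idleValue 1 v d q := by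
    intro q hq
    have e1 := hv.bellman d q hq
    have e2 := hv.bellman (d + 1) q hq
    have e3 := min_le_left (S.idleValue 1 v (d + 1) q) (S.sendValue 1 v (d + 1) q)
    have e4 := min_le_right (S.idleValue 1 v (d + 1) q) (S.sendValue 1 v (d + 1) q)
    have := sub q
    rcases min_choice (S.idleValue 1 v d q) (S.sendValue 1 v d q) with h | h <;>
      rw [h] at e1 <;> linarith
  have one : ∀ q ≤ S.B, 1 ≤ v (d + 1) q - v d q := by
    intro q hq
    refine le_trans ?_ (lower q hq)
    have h := le_mix hl hl1 (h1 (max q 1)) (h1 (q - 1))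
    have h' := mul_le_mul_of_nonneg_left h hp0.le
    unfold sendValue relay
    push_cast
    rw [show d + 1 + 1 = d + 2 from rfl]
    linarith
  have one' : ∀ q, 1 ≤ v (d + 1) q - v d q := by
    intro q
    rcases le_total q S.B with h | h
    · exact one q h
    · rw [hv.saturated _ _ h, hv.saturated _ _ h]; exact one _ le_rfl
  refine ⟨one', fun q => ?_, sub⟩
  -- Transmitting with `q + 1` units reaches the same battery levels as idling with `q`. So `p`
  -- times the idle increment at `q`, plus `1 - p`, is exactly the send increment at `q + 1`.
  rcases lt_or_ge q S.B with h | h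
  · have a1 := lower (q + 1) h
    have a2 := mul_le_mul_of_nonneg_left (upper q h.le) hp0.le
    unfold idleValue at a2
    unfold sendValue relay at a1
    simp only [max_succ_one, Nat.add_sub_cancel, fee_succ] at a1
    push_cast at a1 a2
    linarith
  · rw [hv.saturated _ _ h, hv.saturated d _ h, hv.saturated _ (q + 1) (by omega),
      hv.saturated d (q + 1) (by omega)]
    have := one _ (le_refl S.B)
    nlinarith

theorem increments (hv : S.IsAgeSolution g v) (d : ℕ) :
    (∀ q, 1 ≤ v (d + 1) q - v d q) ∧
    (∀ q, S.p * (v (d + 1) q - v d q) + (1 - S.p) ≤ v (d + 1) (q + 1) - v d (q + 1)) := by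
  obtain ⟨D, -, hD⟩ := hv.exists_increment_eq
  have hp := S.p_lt_one
  have hp0 := S.p_pos
  have h1p : (1 - S.p) ≠ 0 := by linarith
  have hpos : 0 < (1 - S.p)⁻¹ := by rw [inv_pos]; linarith
  have key : ∀ n d, D ≤ d + n → (∀ q, 1 ≤ v (d + 1) q - v d q) ∧
    (∀ q, S.p * (v (d + 1) q - v d q) + (1 - S.p) ≤ v (d + 1) (q + 1) - v d (q + 1)) := by
    intro n
    induction n with
    | zero =>
      intro d hd
      have ha' : (1 - S.p)⁻¹ = 1 + S.p * (1 - S.p)⁻¹ := by field_simp; ring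
      have : 0 ≤ S.p * (1 - S.p)⁻¹ := by positivity
      constructor <;> intro q
      · rw [hD d hd]; linarith
      · rw [hD d hd, hD d hd]; linarith
    | succ n ih =>
      intro d hd
      have := ih (d + 1) (by omega)
      have := hv.increment_step this.1 this.2
      exact ⟨this.1, this.2.1⟩
  exact key D d (by omega)

theorem submodular (hv : S.IsAgeSolution g v) (d q : ℕ) :
    (S.idleValue 1 v d q - S.sendValue 1 v d q) + (1 - S.p) ≤
      S.idleValue 1 v (d + 1) q - S.sendValue 1 v (d + 1) q :=
  (hv.increment_step (hv.increments (d + 1)).1 (hv.increments (d + 1)).2).2.2 q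

/-- A minimum principle: a negative minimum `e` of `v d q - v d (q + 1)` would be exceeded strictly
at every point, including the minimizer. Strictness spreads upward in `q` and, for fixed `q`,
downward in the age from `D`; it travels along the event of no energy arrival, hence `lam < 1`. -/
theorem battery_antitone (hv : S.IsAgeSolution g v) (hlam : S.lam < 1) (d q : ℕ) :
    v d (q + 1) ≤ v d q := by
  obtain ⟨D, hsend, hD⟩ := hv.exists_increment_eq
  have hp := S.p_lt_one
  have hp0 := S.p_pos
  have hl := S.lam_nonneg
  -- Beyond `D` all increments agree, so finitely many ages and battery levels matter and the
  -- minimum is attained.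
  have const : ∀ d q, v d q - v d (q + 1) = v (min d D) q - v (min d D) (q + 1) := by
    intro d q
    rcases le_total d D with h | h
    · rw [min_eq_left h]
    · rw [min_eq_right h]
      induction d, h using Nat.le_induction with
      | base => rfl
      | succ d hd ih =>
        rw [← ih]
        linarith [hD d hd q, hD d hd (q + 1)]
  have zero : ∀ d q, S.B ≤ q → v d q - v d (q + 1) = 0 := by
    intro d q h
    rw [hv.saturated _ _ h, hv.saturated d (q + 1) (by omega), sub_self]
  obtain ⟨⟨d₀, q₀⟩, -, hmin⟩ := Finset.exists_min_image
    (Finset.range (D + 1) ×ˢ Finset.range (S.B + 1))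
    (fun x : ℕ × ℕ => v x.1 x.2 - v x.1 (x.2 + 1)) ⟨(0, 0), by simp⟩
  simp only [Finset.mem_product, Finset.mem_range, and_imp, Prod.forall] at hmin
  set e := v d₀ q₀ - v d₀ (q₀ + 1) with he
  have hle : ∀ d q, e ≤ v d q - v d (q + 1) := by
    intro d q
    rcases le_total S.B q with h | h
    · rw [zero d q h, ← zero 0 S.B le_rfl]
      exact hmin 0 S.B (by omega) (by omega)
    · rw [const]; exact hmin _ _ (by omega) (by omega)
  by_contra hcon
  have hneg : e < 0 := by linarith [hle d q]
  have strict : ∀ q d, e < v d q - v d (q + 1) := by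
    intro q
    induction q with
    | zero =>
      have hB := S.one_lt_B
      -- Transmitting at levels `0` and `1` leads to the same next states; only the fee differs, so
      -- the difference is at least `0 > e`.
      have hs : ∀ d, g + v d 0 = S.sendValue 1 v d 0 → e < v d 0 - v d 1 := by
        intro d h
        have h1 := (hv.bellman d 1 (by omega)).le.trans (min_le_right _ _)
        unfold sendValue at h h1
        simp [fee] at h h1
        linarith [S.updateCost_nonneg]
      have key : ∀ n d, D ≤ d + n → e < v d 0 - v d 1 := by
        intro n
        induction n with
        | zero =>
          intro d hd
          have h0 := hv.bellman d 0 (by omega)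
          rw [min_eq_right (hsend d hd 0).le] at h0
          exact hs d h0
        | succ n ih =>
          intro d hd
          have h0 := hv.bellman d 0 (by omega)
          rcases min_choice (S.idleValue 1 v d 0) (S.sendValue 1 v d 0) with h | h
          · rw [h] at h0
            have h1 := (hv.bellman d 1 (by omega)).le.trans (min_le_left _ _)
            unfold idleValue at h0 h1
            have i1 := mul_le_mul_of_nonneg_left (hle (d + 1) 1) hl
            have i2 := mul_lt_mul_of_pos_left (ih (d + 1) (by omega)) (sub_pos.2 hlam)
            simp only [zero_add] at *
            linarith
          · rw [h] at h0; exact hs d h0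
      exact fun d => key D d (by omega)
    | succ q ihq =>
      rcases le_or_gt S.B (q + 1) with hB | hB
      · intro d; rw [zero d _ hB]; exact hneg
      have hs : ∀ d, g + v d (q + 1) = S.sendValue 1 v d (q + 1) →
          e < v d (q + 1) - v d (q + 1 + 1) := by
        intro d h
        have h1 := (hv.bellman d (q + 1 + 1) (by omega)).le.trans (min_le_right _ _)
        unfold sendValue relay at h h1
        simp only [max_succ_one, Nat.add_sub_cancel, fee_succ] at h h1
        have i1 := le_mix hp0.le hp.le (hle (d + 1) (q + 1)) (hle 0 (q + 1))
        have i2 : e < S.p * (v (d + 1) q - v (d + 1) (q + 1)) +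
            (1 - S.p) * (v 0 q - v 0 (q + 1)) := by
          have j1 := mul_lt_mul_of_pos_left (ihq (d + 1)) hp0
          have j2 := mul_lt_mul_of_pos_left (ihq 0) (sub_pos.2 hp)
          linarith
        have i3 := mul_le_mul_of_nonneg_left i1 hl
        have i4 := mul_lt_mul_of_pos_left i2 (sub_pos.2 hlam)
        linarith
      have key : ∀ n d, D ≤ d + n → e < v d (q + 1) - v d (q + 1 + 1) := by
        intro n
        induction n with
        | zero =>
          intro d hd
          have h0 := hv.bellman d (q + 1) hB.le
          rw [min_eq_right (hsend d hd _).le] at h0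
          exact hs d h0
        | succ n ih =>
          intro d hd
          have h0 := hv.bellman d (q + 1) hB.le
          rcases min_choice (S.idleValue 1 v d (q + 1)) (S.sendValue 1 v d (q + 1)) with h | h
          · rw [h] at h0
            have h1 := (hv.bellman d (q + 1 + 1) hB).le.trans (min_le_left _ _)
            unfold idleValue at h0 h1
            have i1 := mul_le_mul_of_nonneg_left (hle (d + 1) (q + 1 + 1)) hl
            have i2 := mul_lt_mul_of_pos_left (ih (d + 1) (by omega)) (sub_pos.2 hlam)
            linarith
          · rw [h] at h0; exact hs d h0
      exact fun d => key D d (by omega)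
  exact (strict q₀ d₀).ne he

end IsAgeSolution

end

end UpdateSystem

/-! ### Existence of a solution by vanishing discount. -/

namespace UpdateSystem

noncomputable section

/-- The `β`-discounted Bellman operator. -/
def bellmanStep (S : UpdateSystem) (β : ℝ) (v : ℕ → ℕ → ℝ) (d q : ℕ) : ℝ :=
  min (S.idleValue β v d (min q S.B)) (S.sendValue β v d (min q S.B))

/-- Value iteration started from zero. -/
def valueIter (S : UpdateSystem) (β : ℝ) : ℕ → ℕ → ℕ → ℝ
  | 0 => fun _ _ => 0
  | n + 1 => S.bellmanStep β (valueIter S β n)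

/-- A bound for the excess of values over the line of slope `(1 - p)⁻¹`. -/
def excess (S : UpdateSystem) : ℝ :=
  (1 - S.p)⁻¹ * (S.w * S.Cr + S.p * (1 - S.p)⁻¹)

/-- The regularity shared by all discounted value functions. -/
structure IsTame (S : UpdateSystem) (v : ℕ → ℕ → ℝ) : Prop where
  nonneg : ∀ d q, 0 ≤ v d q
  age : ∀ d q, v d q ≤ v (d + 1) q
  battery : ∀ d q, v d (q + 1) ≤ v d q
  battery_le : ∀ d q, v d q ≤ v d (q + 1) + S.w * S.Cr
  saturated : ∀ d q, S.B ≤ q → v d q = v d S.B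
  upper : ∀ d q : ℕ, v d q ≤ v 0 0 + ((1 - S.p)⁻¹ * ((d : ℝ) + 1) + S.excess)

variable {S : UpdateSystem} {β : ℝ} {v v' : ℕ → ℕ → ℝ}

theorem inv_one_sub_p_pos : 0 < (1 - S.p)⁻¹ := by
  have := S.p_lt_one
  rw [inv_pos]; linarith

theorem inv_one_sub_p_eq : (1 - S.p)⁻¹ = 1 + S.p * (1 - S.p)⁻¹ := by
  have := S.p_lt_one
  have : 1 - S.p ≠ 0 := by linarith
  field_simp; ring

theorem excess_eq : S.excess = S.w * S.Cr + S.p * (1 - S.p)⁻¹ + S.p * S.excess := by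
  unfold excess
  linear_combination (S.w * S.Cr + S.p * (1 - S.p)⁻¹) * S.inv_one_sub_p_eq

theorem excess_nonneg : 0 ≤ S.excess := by
  have := S.inv_one_sub_p_pos
  have := S.updateCost_nonneg
  have := S.p_pos
  unfold excess
  positivity

theorem idleValue_mono (hβ : 0 ≤ β) (h : ∀ d q, v d q ≤ v' d q) (d q : ℕ) :
    S.idleValue β v d q ≤ S.idleValue β v' d q := by
  have := mul_le_mul_of_nonneg_left
    (mix_mono S.lam_nonneg S.lam_le_one (h (d + 1) (q + 1)) (h (d + 1) q)) hβ
  unfold idleValue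
  linarith

theorem relay_mono (h : ∀ d q, v d q ≤ v' d q) (d q : ℕ) : S.relay v d q ≤ S.relay v' d q :=
  mix_mono S.p_pos.le S.p_lt_one.le (h _ _) (h _ _)

theorem sendValue_mono (hβ : 0 ≤ β) (h : ∀ d q, v d q ≤ v' d q) (d q : ℕ) :
    S.sendValue β v d q ≤ S.sendValue β v' d q := by
  have := mul_le_mul_of_nonneg_left (mix_mono S.lam_nonneg S.lam_le_one
    (relay_mono (S := S) h d (max q 1)) (relay_mono (S := S) h d (q - 1))) hβ
  unfold sendValue
  linarith

theorem bellmanStep_mono (hβ : 0 ≤ β) (h : ∀ d q, v d q ≤ v' d q) (d q : ℕ) :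
    S.bellmanStep β v d q ≤ S.bellmanStep β v' d q :=
  min_le_min (idleValue_mono hβ h _ _) (sendValue_mono hβ h _ _)

theorem bellmanStep_saturated (d q : ℕ) (h : S.B ≤ q) :
    S.bellmanStep β v d q = S.bellmanStep β v d S.B := by
  simp [bellmanStep, h]

namespace IsTame

theorem relay_antitone (hv : S.IsTame v) (d : ℕ) : Antitone (S.relay v d) :=
  antitone_nat_of_succ_le fun q =>
    mix_mono S.p_pos.le S.p_lt_one.le (hv.battery _ q) (hv.battery _ q)

theorem relay_le (hv : S.IsTame v) (d q : ℕ) :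
    S.relay v d q ≤ S.relay v d (q + 1) + S.w * S.Cr := by
  have := mix_mono S.p_pos.le S.p_lt_one.le (hv.battery_le (d + 1) q) (hv.battery_le 0 q)
  unfold relay
  linarith

theorem le_zero_zero (hv : S.IsTame v) (q : ℕ) : v 0 q ≤ v 0 0 :=
  antitone_nat_of_succ_le (hv.battery 0) (Nat.zero_le q)

/-- Each of at most `B` battery units is worth at most one backup update. The bound does not involve
the discount factor, as the compactness argument requires. -/
theorem zero_zero_le (hv : S.IsTame v) (d q : ℕ) : v 0 0 - S.B * (S.w * S.Cr) ≤ v d q := by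
  have h1 : ∀ q : ℕ, v 0 0 - q * (S.w * S.Cr) ≤ v 0 q := by
    intro q
    induction q with
    | zero => simp
    | succ q ih => have := hv.battery_le 0 q; push_cast; linarith
  have h2 : v 0 q ≤ v d q := monotone_nat_of_le_succ (fun d => hv.age d q) (Nat.zero_le d)
  rcases le_total q S.B with h | h
  · have : (q : ℝ) ≤ S.B := by exact_mod_cast h
    have := mul_le_mul_of_nonneg_right this S.updateCost_nonneg
    linarith [h1 q]
  · rw [hv.saturated 0 q h] at h2
    linarith [h1 S.B]

theorem relay_upper (hv : S.IsTame v) (d q : ℕ) :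
    S.relay v d q ≤ v 0 0 + S.p * ((1 - S.p)⁻¹ * ((d : ℝ) + 2) + S.excess) := by
  have h1 := hv.upper (d + 1) q
  push_cast at h1
  have := mix_mono S.p_pos.le S.p_lt_one.le h1 (hv.le_zero_zero q)
  unfold relay
  linarith

theorem bellmanStep_upper (hv : S.IsTame v) (h0 : 0 ≤ β) (d q : ℕ) :
    S.bellmanStep β v d q ≤ (d : ℝ) + 1 + S.w * S.Cr +
      β * (v 0 0 + S.p * ((1 - S.p)⁻¹ * ((d : ℝ) + 2) + S.excess)) := by
  refine (min_le_right _ _).trans ?_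
  have h1 := S.fee_le (min q S.B)
  have h2 := mul_le_mul_of_nonneg_left (mix_le S.lam_nonneg S.lam_le_one
    (hv.relay_upper d (max (min q S.B) 1)) (hv.relay_upper d (min q S.B - 1))) h0
  unfold sendValue
  linarith

/-- `hle` is needed only for the upper bound, whose reference value `v 0 0` must be replaced by its
image under the operator. -/
theorem step (hv : S.IsTame v) (h0 : 0 ≤ β) (h1 : β ≤ 1) (hle : v 0 0 ≤ S.bellmanStep β v 0 0) :
    S.IsTame (S.bellmanStep β v) := by
  have hl := S.lam_nonneg
  have hl1 := S.lam_le_one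
  have hc := S.updateCost_nonneg
  have scale : ∀ {x y c : ℝ}, 0 ≤ c → x ≤ y + c → β * x ≤ β * y + c := by
    intro x y c hc h
    nlinarith [mul_le_mul_of_nonneg_left h h0, mul_le_mul_of_nonneg_right h1 hc]
  refine ⟨fun d q => ?_, fun d q => ?_, fun d q => ?_, fun d q => ?_, bellmanStep_saturated,
    fun d q => ?_⟩
  · have hr : ∀ q, 0 ≤ S.relay v d q := fun q =>
      le_mix S.p_pos.le S.p_lt_one.le (hv.nonneg _ _) (hv.nonneg _ _)
    have := Nat.cast_nonneg (α := ℝ) d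
    refine le_min ?_ ?_
    · have := mul_nonneg h0 (le_mix hl hl1 (hv.nonneg (d + 1) (min q S.B + 1))
        (hv.nonneg (d + 1) (min q S.B)))
      unfold idleValue; linarith
    · have := mul_nonneg h0 (le_mix hl hl1 (hr (max (min q S.B) 1)) (hr (min q S.B - 1)))
      have := S.fee_nonneg (min q S.B)
      unfold sendValue; linarith
  · have hr : ∀ q, S.relay v d q ≤ S.relay v (d + 1) q := fun q =>
      mix_mono S.p_pos.le S.p_lt_one.le (hv.age _ _) le_rfl
    refine min_le_min ?_ ?_
    · have := mul_le_mul_of_nonneg_left (mix_mono hl hl1 (hv.age (d + 1) (min q S.B + 1))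
        (hv.age (d + 1) (min q S.B))) h0
      unfold idleValue; push_cast; linarith
    · have := mul_le_mul_of_nonneg_left
        (mix_mono hl hl1 (hr (max (min q S.B) 1)) (hr (min q S.B - 1))) h0
      unfold sendValue; push_cast; linarith
  · rcases le_or_gt S.B q with h | h
    · rw [bellmanStep_saturated d q h, bellmanStep_saturated d (q + 1) (by omega)]
    · unfold bellmanStep
      rw [min_eq_left h.le, min_eq_left (show q + 1 ≤ S.B from h)]
      refine min_le_min ?_ ?_
      · have := mul_le_mul_of_nonneg_left (mix_mono hl hl1 (hv.battery (d + 1) (q + 1))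
          (hv.battery (d + 1) q)) h0
        unfold idleValue; linarith
      · have := mul_le_mul_of_nonneg_left (mix_mono hl hl1
          (hv.relay_antitone d (show max q 1 ≤ max (q + 1) 1 by omega))
          (hv.relay_antitone d (show q - 1 ≤ q + 1 - 1 by omega))) h0
        have := S.fee_nonneg q
        have := S.fee_succ q
        unfold sendValue; linarith
  · rcases le_or_gt S.B q with h | h
    · rw [bellmanStep_saturated d q h, bellmanStep_saturated d (q + 1) (by omega)]
      linarith
    · unfold bellmanStep
      rw [min_eq_left h.le, min_eq_left (show q + 1 ≤ S.B from h), ← min_add_add_right]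
      refine min_le_min ?_ ?_
      · have := mix_mono hl hl1 (hv.battery_le (d + 1) (q + 1)) (hv.battery_le (d + 1) q)
        have := scale (y := S.lam * v (d + 1) (q + 1 + 1) + (1 - S.lam) * v (d + 1) (q + 1)) hc
          (this.trans (by linarith))
        unfold idleValue; linarith
      -- At levels `0` and `1` transmitting has the same continuation, so the values differ by
      -- exactly the fee.
      · cases q with
        | zero => simp [sendValue, add_assoc, add_comm]
        | succ q =>
          have := mix_mono hl hl1 (hv.relay_le d (q + 1)) (hv.relay_le d q)
          have := scale (y := S.lam * S.relay v d (q + 1 + 1) + (1 - S.lam) * S.relay v d (q + 1))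
            hc (this.trans (by linarith))
          simp only [sendValue, max_succ_one, Nat.add_sub_cancel, fee_succ]
          linarith
  · refine (hv.bellmanStep_upper h0 d q).trans ?_
    have e1 := S.inv_one_sub_p_eq
    have e2 := S.excess_eq
    have h2 : 0 ≤ v 0 0 + S.p * ((1 - S.p)⁻¹ * ((d : ℝ) + 2) + S.excess) := by
      have := hv.nonneg 0 0
      have := S.p_pos
      have := S.inv_one_sub_p_pos
      have := S.excess_nonneg
      positivity
    have h3 := mul_le_mul_of_nonneg_right h1 h2
    have e3 : (1 - S.p)⁻¹ * ((d : ℝ) + 1) = (d + 1) + S.p * (1 - S.p)⁻¹ * (d + 1) := by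
      linear_combination ((d : ℝ) + 1) * e1
    linarith

end IsTame

theorem isTame_zero : S.IsTame (fun _ _ => 0) := by
  refine ⟨fun _ _ => le_rfl, fun _ _ => le_rfl, fun _ _ => le_rfl,
    fun _ _ => by simpa using S.updateCost_nonneg, fun _ _ _ => rfl, fun d _ => ?_⟩
  have := S.inv_one_sub_p_pos
  have := S.excess_nonneg
  positivity

theorem valueIter_mono (h0 : 0 ≤ β) (n d q : ℕ) :
    S.valueIter β n d q ≤ S.valueIter β (n + 1) d q := by
  induction n generalizing d q with
  | zero =>
    have := Nat.cast_nonneg (α := ℝ) d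
    have := S.fee_nonneg (min q S.B)
    refine le_min ?_ ?_
    · simp only [valueIter, idleValue]; linarith
    · simp only [valueIter, sendValue, relay]; linarith
  | succ n ih => exact bellmanStep_mono h0 ih d q

theorem isTame_valueIter (h0 : 0 ≤ β) (h1 : β ≤ 1) (n : ℕ) : S.IsTame (S.valueIter β n) := by
  induction n with
  | zero => exact isTame_zero
  | succ n ih => exact ih.step h0 h1 (valueIter_mono h0 n 0 0)

/-- A bound for the discounted cost per slot. -/
def gainBound (S : UpdateSystem) : ℝ :=
  1 + S.w * S.Cr + S.p * ((1 - S.p)⁻¹ * 2 + S.excess)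

/-- The iterates increase, so transmitting once gives `x ≤ gainBound + β * x` for the iterate `x` at
the origin. -/
theorem valueIter_zero_zero_le (h0 : 0 ≤ β) (h1 : β < 1) (n : ℕ) :
    S.valueIter β n 0 0 ≤ S.gainBound / (1 - β) := by
  rw [le_div_iff₀ (sub_pos.2 h1)]
  have h := (valueIter_mono (S := S) h0 n 0 0).trans
    ((isTame_valueIter (S := S) h0 h1.le n).bellmanStep_upper h0 0 0)
  have h2 : 0 ≤ S.p * ((1 - S.p)⁻¹ * 2 + S.excess) := by
    have := S.p_pos
    have := S.inv_one_sub_p_pos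
    have := S.excess_nonneg
    positivity
  have h3 := mul_le_mul_of_nonneg_right h1.le h2
  unfold gainBound
  push_cast at h
  rw [zero_add, zero_add] at h
  linarith

theorem tendsto_idleValue {ι : Type*} {l : Filter ι} {b : ι → ℝ} {u : ι → ℕ → ℕ → ℝ}
    (hb : Tendsto b l (nhds β)) (hu : ∀ d q, Tendsto (fun i => u i d q) l (nhds (v d q)))
    (d q : ℕ) :
    Tendsto (fun i => S.idleValue (b i) (u i) d q) l (nhds (S.idleValue β v d q)) :=
  (hb.mul (((hu _ _).const_mul _).add ((hu _ _).const_mul _))).const_add _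

theorem tendsto_sendValue {ι : Type*} {l : Filter ι} {b : ι → ℝ} {u : ι → ℕ → ℕ → ℝ}
    (hb : Tendsto b l (nhds β)) (hu : ∀ d q, Tendsto (fun i => u i d q) l (nhds (v d q)))
    (d q : ℕ) :
    Tendsto (fun i => S.sendValue (b i) (u i) d q) l (nhds (S.sendValue β v d q)) := by
  have hr : ∀ d q, Tendsto (fun i => S.relay (u i) d q) l (nhds (S.relay v d q)) := fun d q =>
    ((hu _ _).const_mul _).add ((hu _ _).const_mul _)
  exact (hb.mul (((hr _ _).const_mul _).add ((hr _ _).const_mul _))).const_add _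

theorem tendsto_bellmanStep {ι : Type*} {l : Filter ι} {b : ι → ℝ} {u : ι → ℕ → ℕ → ℝ}
    (hb : Tendsto b l (nhds β)) (hu : ∀ d q, Tendsto (fun i => u i d q) l (nhds (v d q)))
    (d q : ℕ) :
    Tendsto (fun i => S.bellmanStep (b i) (u i) d q) l (nhds (S.bellmanStep β v d q)) :=
  (tendsto_idleValue hb hu _ _).min (tendsto_sendValue hb hu _ _)

/-- Existence of the discounted value function. -/
theorem exists_discounted (h0 : 0 ≤ β) (h1 : β < 1) :
    ∃ v, S.IsTame v ∧ (∀ d q, v d q = S.bellmanStep β v d q) ∧ (1 - β) * v 0 0 ≤ S.gainBound := by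
  have tame := isTame_valueIter (S := S) h0 h1.le
  have hlim : ∀ d q, ∃ x, Tendsto (fun n => S.valueIter β n d q) atTop (nhds x) := by
    intro d q
    refine ⟨_, tendsto_atTop_ciSup (monotone_nat_of_le_succ fun n => valueIter_mono h0 n d q)
      ⟨S.gainBound / (1 - β) + ((1 - S.p)⁻¹ * ((d : ℝ) + 1) + S.excess), ?_⟩⟩
    rintro _ ⟨n, rfl⟩
    have := (tame n).upper d q
    have := valueIter_zero_zero_le (S := S) h0 h1 n
    simp only
    linarith
  choose v hv using hlim
  refine ⟨v, ⟨fun d q => ge_of_tendsto' (hv d q) fun n => (tame n).nonneg d q,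
    fun d q => le_of_tendsto_of_tendsto' (hv _ _) (hv _ _) fun n => (tame n).age d q,
    fun d q => le_of_tendsto_of_tendsto' (hv _ _) (hv _ _) fun n => (tame n).battery d q,
    fun d q => le_of_tendsto_of_tendsto' (hv _ _) ((hv _ _).add_const _)
      fun n => (tame n).battery_le d q,
    fun d q h => tendsto_nhds_unique (hv d q) ((hv d S.B).congr fun n =>
      ((tame n).saturated d q h).symm),
    fun d q => le_of_tendsto_of_tendsto' (hv _ _) ((hv _ _).add_const _)
      fun n => (tame n).upper d q⟩, fun d q => ?_, ?_⟩
  · exact tendsto_nhds_unique ((tendsto_add_atTop_iff_nat 1).2 (hv d q))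
      (tendsto_bellmanStep tendsto_const_nhds hv d q)
  · have := le_of_tendsto' (hv 0 0) (valueIter_zero_zero_le (S := S) h0 h1)
    rw [le_div_iff₀ (sub_pos.2 h1)] at this
    linarith

theorem bellmanStep_sub_const (x : ℝ) (d q : ℕ) :
    S.bellmanStep β (fun d q => v d q - x) d q = S.bellmanStep β v d q - β * x := by
  unfold bellmanStep
  rw [← min_sub_sub_right]
  congr 1
  · unfold idleValue; ring
  · unfold sendValue relay; ring

/-- One ultrafilter yields limits at all states simultaneously, in place of a diagonal subsequence.
-/
theorem exists_ultrafilter_limit (F : Ultrafilter ℕ) {f : ℕ → ℝ} {x y : ℝ}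
    (h : ∀ n, f n ∈ Set.Icc x y) : ∃ z ∈ Set.Icc x y, Tendsto f F (nhds z) := by
  refine isCompact_Icc.ultrafilter_le_nhds (F.map f) ?_
  rw [le_principal_iff]
  exact mem_map.2 (Filter.univ_mem' h)

/-- Existence of a solution of the average-cost Bellman equation, by vanishing discount. -/
theorem exists_isAgeSolution (S : UpdateSystem) : ∃ g v, S.IsAgeSolution g v := by
  let b : ℕ → ℝ := fun n => 1 - 1 / ((n : ℝ) + 1)
  have hb0 : ∀ n, 0 ≤ b n := fun n => by
    have : 1 / ((n : ℝ) + 1) ≤ 1 := by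
      rw [div_le_one (by positivity)]; linarith [Nat.cast_nonneg (α := ℝ) n]
    simp only [b]; linarith
  have hb1 : ∀ n, b n < 1 := fun n => by
    have : 0 < 1 / ((n : ℝ) + 1) := by positivity
    simp only [b]; linarith
  have hb : Tendsto b atTop (nhds 1) := by
    simpa [b] using (tendsto_one_div_add_atTop_nhds_zero_nat (𝕜 := ℝ)).const_sub 1
  choose u tame hu hg using fun n => exists_discounted (S := S) (hb0 n) (hb1 n)
  let F : Ultrafilter ℕ := hyperfilter ℕ
  have hF : (F : Filter ℕ) ≤ atTop := Nat.hyperfilter_le_atTop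
  obtain ⟨g, -, hgl⟩ := exists_ultrafilter_limit F (f := fun n => (1 - b n) * u n 0 0)
    (x := 0) (y := S.gainBound) fun n =>
      ⟨mul_nonneg (by linarith [hb1 n]) ((tame n).nonneg 0 0), hg n⟩
  have hh : ∀ d q : ℕ, ∃ z ∈ Set.Icc (-(S.B * (S.w * S.Cr)))
      ((1 - S.p)⁻¹ * ((d : ℝ) + 1) + S.excess), Tendsto (fun n => u n d q - u n 0 0) F (nhds z) :=
    fun d q => exists_ultrafilter_limit F fun n =>
      ⟨by linarith [(tame n).zero_zero_le d q], by linarith [(tame n).upper d q]⟩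
  choose h hmem hlim using hh
  refine ⟨g, h, fun d q hq => ?_, fun d q hq => ?_, ⟨_, fun d q => (hmem d q).1⟩,
    (1 - S.p)⁻¹ + S.excess, 1, fun d q => ?_⟩
  · have h1 := tendsto_bellmanStep (S := S) (hb.mono_left hF) hlim d q
    have h2 := tendsto_nhds_unique (hgl.add (hlim d q)) (h1.congr fun n => ?_)
    · simpa [bellmanStep, hq] using h2
    -- Subtracting `u n 0 0` from the value function lowers its Bellman image by only `b n * u n 0
    -- 0`; the remainder `(1 - b n) * u n 0 0` is what converges to the gain.
    · rw [bellmanStep_sub_const, ← hu n d q]; ring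
  · exact tendsto_nhds_unique (hlim d q) ((hlim d S.B).congr fun n => by
      rw [(tame n).saturated d q hq])
  · refine (hmem d q).2.trans ?_
    have := S.excess_nonneg
    have := mul_nonneg this (Nat.cast_nonneg (α := ℝ) d)
    rw [pow_one]
    linarith

end

end UpdateSystem

/-! ### The transition law in coordinates. -/

theorem coin_bind_apply {α : Type*} (r : ℝ) (h0 : 0 ≤ r) (h1 : r ≤ 1) (f : Bool → PMF α) (y : α) :
    ((coin r h0 h1).bind f) y =
      ENNReal.ofReal r * f true y + ENNReal.ofReal (1 - r) * f false y := by
  rw [PMF.bind_apply, tsum_bool, add_comm]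
  simp [coin]

theorem hasSum_coin_bind {α : Type*} {r : ℝ} (h0 : 0 ≤ r) (h1 : r ≤ 1) {f : Bool → PMF α}
    {V : α → ℝ} {A A' : ℝ} (hA : HasSum (fun y => (f true y).toReal * V y) A)
    (hA' : HasSum (fun y => (f false y).toReal * V y) A') :
    HasSum (fun y => (((coin r h0 h1).bind f) y).toReal * V y) (r * A + (1 - r) * A') := by
  refine ((hA.mul_left r).add (hA'.mul_left (1 - r))).congr_fun ?_
  intro y
  rw [coin_bind_apply, ENNReal.toReal_add
    (ENNReal.mul_ne_top ENNReal.ofReal_ne_top ((f true).apply_ne_top y))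
    (ENNReal.mul_ne_top ENNReal.ofReal_ne_top ((f false).apply_ne_top y)),
    ENNReal.toReal_mul, ENNReal.toReal_mul, ENNReal.toReal_ofReal h0,
    ENNReal.toReal_ofReal (sub_nonneg.2 h1)]
  ring

theorem hasSum_pmf_pure {α : Type*} (V : α → ℝ) (z : α) :
    HasSum (fun y => (PMF.pure z y).toReal * V y) (V z) := by
  have h := hasSum_single (f := fun y => (PMF.pure z y).toReal * V y) z
    (fun y hy => by simp [PMF.pure_apply, hy])
  simpa using h

namespace UpdateSystem

noncomputable section

variable {S : UpdateSystem}

theorem hasSum_transition (V : S.State → ℝ) (x : S.State) (a : Action) :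
    HasSum (fun x' => (S.transition x a x').toReal * V x')
      (S.lam * (S.p * V (nextAge x.1 a true, S.nextBattery x.2 a true) +
          (1 - S.p) * V (nextAge x.1 a false, S.nextBattery x.2 a true)) +
        (1 - S.lam) * (S.p * V (nextAge x.1 a true, S.nextBattery x.2 a false) +
          (1 - S.p) * V (nextAge x.1 a false, S.nextBattery x.2 a false))) :=
  hasSum_coin_bind _ _ (hasSum_coin_bind _ _ (hasSum_pmf_pure V _) (hasSum_pmf_pure V _))
    (hasSum_coin_bind _ _ (hasSum_pmf_pure V _) (hasSum_pmf_pure V _))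

/-- A function of the state, as a function of the age minus one and the battery level. -/
def coord (V : S.State → ℝ) (d q : ℕ) : ℝ :=
  V (d.succPNat, ⟨min q S.B, Nat.lt_succ_of_le (min_le_right _ _)⟩)

theorem coord_apply (V : S.State → ℝ) (d : ℕ) (q : Fin (S.B + 1)) :
    coord V d q = V (d.succPNat, q) := by
  unfold coord
  congr 2
  exact Fin.ext (min_eq_left (Nat.le_of_lt_succ q.2))

theorem nextAge_idle (d : ℕ) (e : Bool) : nextAge d.succPNat 0 e = (d + 1).succPNat := by
  simp [nextAge]
  rfl

theorem nextAge_erased (d : ℕ) : nextAge d.succPNat 1 true = (d + 1).succPNat := by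
  simp [nextAge]
  rfl

theorem nextAge_received (d : ℕ) : nextAge d.succPNat 1 false = (0 : ℕ).succPNat := by
  simp [nextAge]
  rfl

theorem eq_coord (V : S.State → ℝ) (d q : ℕ) (q' : Fin (S.B + 1)) (h : (q' : ℕ) = min q S.B) :
    V (d.succPNat, q') = coord V d q := by
  unfold coord
  congr 2
  exact Fin.ext h

theorem Q_zero (V : S.State → ℝ) (d : ℕ) (q : Fin (S.B + 1)) :
    S.Q V (d.succPNat, q) 0 = S.idleValue 1 (coord V) d q := by
  have hq := Nat.le_of_lt_succ q.2
  unfold Q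
  rw [(hasSum_transition V _ _).tsum_eq]
  simp only [nextAge_idle]
  rw [eq_coord V (d + 1) (q + 1) (S.nextBattery q 0 true) (by simp [nextBattery]),
    eq_coord V (d + 1) q (S.nextBattery q 0 false) (by simp [nextBattery])]
  simp [cost, idleValue]
  ring

theorem Q_one (V : S.State → ℝ) (d : ℕ) (q : Fin (S.B + 1)) :
    S.Q V (d.succPNat, q) 1 = S.sendValue 1 (coord V) d q := by
  have hB := S.one_lt_B
  have hq := Nat.le_of_lt_succ q.2
  have ht : (S.nextBattery q 1 true : ℕ) = min (max (q : ℕ) 1) S.B := by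
    simp only [nextBattery, step]
    split_ifs <;> simp <;> omega
  have hf : (S.nextBattery q 1 false : ℕ) = min ((q : ℕ) - 1) S.B := by
    simp only [nextBattery, step]
    split_ifs <;> simp_all
  have hc : S.cost (d.succPNat, q) 1 = (d : ℝ) + 1 + S.fee q := by
    unfold cost fee step
    rcases Nat.eq_zero_or_pos (q : ℕ) with h | h
    · simp [h]
    · simp [h, h.ne']
  unfold Q
  rw [(hasSum_transition V _ _).tsum_eq, hc]
  simp only [nextAge_erased, nextAge_received]
  rw [eq_coord V (d + 1) _ _ ht, eq_coord V 0 _ _ ht, eq_coord V (d + 1) _ _ hf,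
    eq_coord V 0 _ _ hf]
  unfold sendValue relay
  ring

theorem IsRelativeValue.isAgeSolution {g : ℝ} {V : S.State → ℝ} (hV : S.IsRelativeValue g V) :
    S.IsAgeSolution g (coord V) := by
  refine ⟨fun d q hq => ?_, fun d q hq => ?_, ?_, ?_⟩
  · have h := hV.bellman (d.succPNat, ⟨q, Nat.lt_succ_of_le hq⟩)
    rw [Q_zero, Q_one, ← coord_apply V d ⟨q, Nat.lt_succ_of_le hq⟩] at h
    exact h
  · simp [coord, hq]
  · obtain ⟨k, hk⟩ := hV.bddBelow
    exact ⟨-k, fun d q => by rw [neg_neg]; exact hk ⟨_, rfl⟩⟩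
  · obtain ⟨K, m, h⟩ := hV.growth
    refine ⟨K, m, fun d q => ?_⟩
    have := h (d.succPNat, ⟨min q S.B, Nat.lt_succ_of_le (min_le_right _ _)⟩)
    rwa [Nat.succPNat_coe, Nat.cast_succ] at this

theorem exists_isRelativeValue (S : UpdateSystem) :
    ∃ (g : ℝ) (V : S.State → ℝ), S.IsRelativeValue g V := by
  obtain ⟨g, v, hv⟩ := S.exists_isAgeSolution
  have hc : coord (S := S) (fun x => v x.1.natPred x.2) = v := by
    funext d q
    simp only [coord, Nat.natPred_succPNat]
    rcases le_total q S.B with h | h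
    · rw [min_eq_left h]
    · rw [min_eq_right h, hv.saturated d q h]
  refine ⟨g, fun x => v x.1.natPred x.2, fun x => ?_, ?_, ?_⟩
  · obtain ⟨Δ, q⟩ := x
    obtain ⟨d, rfl⟩ : ∃ d : ℕ, Δ = d.succPNat := ⟨Δ.natPred, (PNat.succPNat_natPred Δ).symm⟩
    rw [Q_zero, Q_one, hc]
    simpa using hv.bellman d q (Nat.le_of_lt_succ q.2)
  · obtain ⟨k, hk⟩ := hv.bddBelow
    exact ⟨-k, by rintro _ ⟨x, rfl⟩; exact hk _ _⟩
  · obtain ⟨K, m, h⟩ := hv.growth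
    refine ⟨K, m, fun x => ?_⟩
    have h1 := h x.1.natPred x.2
    have h2 : ((x.1.natPred : ℕ) : ℝ) + 1 = ((x.1 : ℕ) : ℝ) := by
      exact_mod_cast PNat.natPred_add_one x.1
    rwa [h2] at h1

end

end UpdateSystem

/-! ### Means in `[0, ∞]` and long-run averages. -/

/-- The mean of a nonnegative function. -/
noncomputable def PMF.mean {α : Type*} (P : PMF α) (f : α → ℝ≥0∞) : ℝ≥0∞ := ∑' y, P y * f y

namespace PMF

variable {α β : Type*}

theorem mean_mono (P : PMF α) {f g : α → ℝ≥0∞} (h : ∀ y, f y ≤ g y) : P.mean f ≤ P.mean g :=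
  ENNReal.tsum_le_tsum fun y => mul_le_mul_right (h y) _

theorem mean_add (P : PMF α) (f g : α → ℝ≥0∞) :
    P.mean (fun y => f y + g y) = P.mean f + P.mean g := by
  simp only [mean, mul_add, ENNReal.tsum_add]

theorem mean_const (P : PMF α) (c : ℝ≥0∞) : P.mean (fun _ => c) = c := by
  simp only [mean, ENNReal.tsum_mul_right, P.tsum_coe, one_mul]

theorem mean_const_mul (P : PMF α) (c : ℝ≥0∞) (f : α → ℝ≥0∞) :
    P.mean (fun y => c * f y) = c * P.mean f := by
  simp only [mean, ← ENNReal.tsum_mul_left]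
  exact tsum_congr fun y => by ring

theorem mean_pure (z : α) (f : α → ℝ≥0∞) : (PMF.pure z).mean f = f z := by
  unfold mean
  rw [tsum_eq_single z fun y hy => by simp [hy]]
  simp

theorem mean_bind (P : PMF α) (κ : α → PMF β) (f : β → ℝ≥0∞) :
    (P.bind κ).mean f = P.mean fun a => (κ a).mean f := by
  simp only [mean, PMF.bind_apply, ← ENNReal.tsum_mul_right, ← ENNReal.tsum_mul_left]
  rw [ENNReal.tsum_comm]
  simp only [mul_assoc]

theorem mean_ofReal (P : PMF α) {f : α → ℝ} {A : ℝ} (hf : ∀ y, 0 ≤ f y)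
    (h : HasSum (fun y => (P y).toReal * f y) A) :
    P.mean (fun y => ENNReal.ofReal (f y)) = ENNReal.ofReal A := by
  rw [← h.tsum_eq, ENNReal.ofReal_tsum_of_nonneg
    (fun y => mul_nonneg ENNReal.toReal_nonneg (hf y)) h.summable]
  refine tsum_congr fun y => ?_
  rw [ENNReal.ofReal_mul ENNReal.toReal_nonneg, ENNReal.ofReal_toReal (P.apply_ne_top y)]

end PMF

/-- If the running sums `∑_{t<T} f t` fall short of `T * G` by at most a multiple of `f T`, then
they cannot stay below `r * T` for an `r < G`. -/
theorem not_running_sum_le {f : ℕ → ℝ} {G r K : ℝ} (hK : 0 < K) (hr : r < G)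
    (hf : ∀ t, 0 ≤ f t) {N : ℕ}
    (h : ∀ T ≥ N, T * G ≤ ∑ t ∈ Finset.range T, f t + K * f T)
    (hs : ∀ T ≥ N, ∑ t ∈ Finset.range T, f t ≤ r * T) : False := by
  have hε : 0 < (G - r) / K := div_pos (sub_pos.2 hr) hK
  have hlow : ∀ T ≥ N, (G - r) / K * T ≤ f T := by
    intro T hT
    rw [div_mul_eq_mul_div, div_le_iff₀ hK]
    linarith [h T hT, hs T hT]
  -- With `ε = (G - r) / K`, the slots from `T` to `2 * T` contribute at least `ε * T ^ 2`, which
  -- exceeds the allowed `2 * r * T` once `T > 2 * r / ε`.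
  obtain ⟨n, hn⟩ := exists_nat_gt (2 * r / ((G - r) / K))
  let T := max (max N 1) n
  have hT1 : (1 : ℝ) ≤ T := by
    exact_mod_cast (le_max_right N 1).trans (le_max_left _ n)
  have hTn : (n : ℝ) ≤ T := by exact_mod_cast le_max_right _ n
  have hTN : N ≤ T := (le_max_left N 1).trans (le_max_left _ n)
  have h1 := hs (T + T) (by omega)
  rw [Finset.sum_range_add] at h1
  have h2 : 0 ≤ ∑ t ∈ Finset.range T, f t := Finset.sum_nonneg fun t _ => hf t
  have h3 : (T : ℝ) * ((G - r) / K * T) ≤ ∑ t ∈ Finset.range T, f (T + t) := by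
    have := Finset.card_nsmul_le_sum (Finset.range T) (fun t => f (T + t)) ((G - r) / K * T)
      fun t _ => by
        refine le_trans ?_ (hlow (T + t) (by omega))
        push_cast
        nlinarith [Nat.cast_nonneg (α := ℝ) t]
    simpa using this
  rw [div_lt_iff₀ hε] at hn
  push_cast at h1
  have h4 : (n : ℝ) * ((G - r) / K) ≤ T * ((G - r) / K) := mul_le_mul_of_nonneg_right hTn hε.le
  nlinarith

/-- If the upper limit were below some `r < G`, all terms would be finite and the real statement
`not_running_sum_le` would apply. -/
theorem le_limsup_average {F : ℕ → ℝ≥0∞} {G K : ℝ}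
    (h : ∀ T : ℕ, (T : ℝ≥0∞) * ENNReal.ofReal G ≤
      ∑ t ∈ Finset.range T, F t + ENNReal.ofReal K * F T) :
    ENNReal.ofReal G ≤ limsup (fun T : ℕ => (∑ t ∈ Finset.range T, F t) / (T : ℝ≥0∞)) atTop := by
  by_contra hcon
  obtain ⟨r, hr1, hr2⟩ := ENNReal.lt_iff_exists_nnreal_btwn.1 (not_le.1 hcon)
  obtain ⟨N, hN⟩ := eventually_atTop.1 (eventually_lt_of_limsup_lt hr1)
  have hsum : ∀ T ≥ max N 1, ∑ t ∈ Finset.range T, F t ≤ r * T := by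
    intro T hT
    have h1 := (hN T ((le_max_left _ _).trans hT)).le
    have hT0 : (T : ℝ≥0∞) ≠ 0 := by
      have : 1 ≤ T := (le_max_right _ _).trans hT
      exact_mod_cast (by omega : T ≠ 0)
    rwa [ENNReal.div_le_iff hT0 (ENNReal.natCast_ne_top T)] at h1
  have hrT : ∀ T : ℕ, (r : ℝ≥0∞) * T ≠ ∞ := fun T =>
    ENNReal.mul_ne_top ENNReal.coe_ne_top (ENNReal.natCast_ne_top T)
  have hfin : ∀ t, F t ≠ ∞ := by
    intro t
    have h1 := hsum (t + max N 1) (by omega)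
    have h2 : F t ≤ ∑ t ∈ Finset.range (t + max N 1), F t :=
      Finset.single_le_sum (f := F) (fun _ _ => zero_le)
        (Finset.mem_range.2 (by have := le_max_right N 1; omega))
    exact ne_top_of_le_ne_top (hrT _) (h2.trans h1)
  have hsfin : ∀ T, ∑ t ∈ Finset.range T, F t ≠ ∞ := fun T =>
    ENNReal.sum_ne_top.2 fun t _ => hfin t
  have hs : ∀ T, (∑ t ∈ Finset.range T, F t).toReal = ∑ t ∈ Finset.range T, (F t).toReal :=
    fun T => ENNReal.toReal_sum fun t _ => hfin t
  have hG0 : 0 < G := by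
    by_contra hG
    rw [ENNReal.ofReal_of_nonpos (not_lt.1 hG)] at hr2
    exact not_lt_zero hr2
  have hrG : (r : ℝ) < G := by
    have := (ENNReal.toReal_lt_toReal ENNReal.coe_ne_top ENNReal.ofReal_ne_top).2 hr2
    rwa [ENNReal.coe_toReal, ENNReal.toReal_ofReal hG0.le] at this
  refine not_running_sum_le (f := fun t => (F t).toReal) (K := |K| + 1) (N := max N 1)
    (by positivity) hrG (fun _ => ENNReal.toReal_nonneg) (fun T _ => ?_) (fun T hT => ?_)
  · have h1 := ENNReal.toReal_mono (ENNReal.add_ne_top.2 ⟨hsfin T,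
      ENNReal.mul_ne_top ENNReal.ofReal_ne_top (hfin T)⟩) (h T)
    rw [ENNReal.toReal_add (hsfin T) (ENNReal.mul_ne_top ENNReal.ofReal_ne_top (hfin T)), hs,
      ENNReal.toReal_mul, ENNReal.toReal_mul, ENNReal.toReal_ofReal hG0.le,
      ENNReal.toReal_natCast] at h1
    have h2 : (ENNReal.ofReal K).toReal ≤ |K| + 1 := by
      rw [ENNReal.toReal_ofReal']
      exact max_le (by linarith [le_abs_self K]) (by positivity)
    exact h1.trans (add_le_add le_rfl (mul_le_mul_of_nonneg_right h2 ENNReal.toReal_nonneg))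
  · have h1 := ENNReal.toReal_mono (hrT T) (hsum T hT)
    rwa [hs, ENNReal.toReal_mul, ENNReal.coe_toReal, ENNReal.toReal_natCast] at h1

theorem limsup_average_le {F : ℕ → ℝ≥0∞} {G c : ℝ≥0∞} (hc : c ≠ ∞)
    (h : ∀ T : ℕ, ∑ t ∈ Finset.range T, F t ≤ T * G + c) :
    limsup (fun T : ℕ => (∑ t ∈ Finset.range T, F t) / (T : ℝ≥0∞)) atTop ≤ G := by
  have hlim : Tendsto (fun T : ℕ => G + c / (T : ℝ≥0∞)) atTop (nhds G) := by
    simpa using (ENNReal.Tendsto.const_div ENNReal.tendsto_nat_nhds_top (Or.inr hc)).const_add G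
  rw [← hlim.limsup_eq]
  refine limsup_le_limsup ?_
  filter_upwards [eventually_ge_atTop 1] with T hT
  have hT0 : (T : ℝ≥0∞) ≠ 0 := by exact_mod_cast (by omega : T ≠ 0)
  rw [ENNReal.div_le_iff hT0 (ENNReal.natCast_ne_top T), add_mul,
    ENNReal.div_mul_cancel hT0 (ENNReal.natCast_ne_top T), mul_comm G]
  exact h T

/-! ### Optimality of greedy policies and the threshold form. -/

namespace UpdateSystem

noncomputable section

variable {S : UpdateSystem}

theorem expectedCost_eq_mean (π : S.Policy) (x₀ : S.State) (t : ℕ) :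
    S.expectedCost π x₀ t = (S.law π x₀ t).mean fun y =>
      (π y.1 y.2).mean fun a => ENNReal.ofReal (S.cost y.2 a) := rfl

theorem mean_law_succ (π : S.Policy) (x₀ : S.State) (t : ℕ) (w : S.State → ℝ≥0∞) :
    (S.law π x₀ (t + 1)).mean (fun y => w y.2) = (S.law π x₀ t).mean fun y =>
      (π y.1 y.2).mean fun a => (S.transition y.2 a).mean w := by
  rw [law]
  simp only [PMF.mean_bind, PMF.mean_pure]

/-- Everything stays in `[0, ∞]`, so nothing is subtracted and no integrability is needed; the
initial term `w x₀` is simply dropped. -/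
theorem telescope_le (π : S.Policy) (x₀ : S.State) {w : S.State → ℝ≥0∞} {G : ℝ≥0∞}
    (h : ∀ x a, G + w x ≤ ENNReal.ofReal (S.cost x a) + (S.transition x a).mean w) (T : ℕ) :
    T * G ≤ ∑ t ∈ Finset.range T, S.expectedCost π x₀ t +
      (S.law π x₀ T).mean fun y => w y.2 := by
  induction T with
  | zero => simp
  | succ T ih =>
    have h1 : G + (S.law π x₀ T).mean (fun y => w y.2) ≤
        S.expectedCost π x₀ T + (S.law π x₀ (T + 1)).mean fun y => w y.2 := by
      rw [mean_law_succ, expectedCost_eq_mean, ← PMF.mean_add]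
      conv_lhs => rw [← PMF.mean_const (S.law π x₀ T) G, ← PMF.mean_add]
      refine PMF.mean_mono _ fun y => ?_
      rw [← PMF.mean_add, ← PMF.mean_const (π y.1 y.2) (G + w y.2)]
      exact PMF.mean_mono _ fun a => h y.2 a
    rw [Finset.sum_range_succ, add_assoc]
    push_cast
    calc ((T : ℝ≥0∞) + 1) * G = T * G + G := by ring
      _ ≤ ∑ t ∈ Finset.range T, S.expectedCost π x₀ t +
          (G + (S.law π x₀ T).mean fun y => w y.2) := by
        rw [add_comm G, ← add_assoc]; gcongr
      _ ≤ _ := by gcongr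

theorem le_telescope (π : S.Stationary) (x₀ : S.State) {w : S.State → ℝ≥0∞} {G : ℝ≥0∞}
    (h : ∀ x, ENNReal.ofReal (S.cost x (π x)) + (S.transition x (π x)).mean w ≤ G + w x) (T : ℕ) :
    ∑ t ∈ Finset.range T, S.expectedCost π.toPolicy x₀ t +
      (S.law π.toPolicy x₀ T).mean (fun y => w y.2) ≤ T * G + w x₀ := by
  induction T with
  | zero => simp [law, PMF.mean_pure]
  | succ T ih =>
    have h1 : S.expectedCost π.toPolicy x₀ T +
        (S.law π.toPolicy x₀ (T + 1)).mean (fun y => w y.2) ≤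
          G + (S.law π.toPolicy x₀ T).mean fun y => w y.2 := by
      rw [mean_law_succ, expectedCost_eq_mean, ← PMF.mean_add]
      conv_rhs => rw [← PMF.mean_const (S.law π.toPolicy x₀ T) G, ← PMF.mean_add]
      refine PMF.mean_mono _ fun y => ?_
      rw [Stationary.toPolicy, PMF.mean_pure, PMF.mean_pure]
      exact h y.2
    rw [Finset.sum_range_succ, add_assoc]
    push_cast
    calc _ ≤ ∑ t ∈ Finset.range T, S.expectedCost π.toPolicy x₀ t +
          (G + (S.law π.toPolicy x₀ T).mean fun y => w y.2) := by gcongr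
      _ = (∑ t ∈ Finset.range T, S.expectedCost π.toPolicy x₀ t +
          (S.law π.toPolicy x₀ T).mean fun y => w y.2) + G := by ring
      _ ≤ (T * G + w x₀) + G := by gcongr
      _ = _ := by ring

theorem age_le_cost (x : S.State) (a : Action) : ((x.1 : ℕ) : ℝ) ≤ S.cost x a := by
  have h1 : ((step x.2 : ℕ) : ℝ) ≤ 1 := by
    unfold step; split_ifs <;> simp
  have := mul_nonneg (mul_nonneg S.updateCost_nonneg (Nat.cast_nonneg (α := ℝ) (a : ℕ)))
    (sub_nonneg.2 h1)
  unfold cost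
  linarith

namespace IsRelativeValue

variable {g : ℝ} {V : S.State → ℝ}

theorem le_Q (hV : S.IsRelativeValue g V) (x : S.State) (a : Action) : g + V x ≤ S.Q V x a := by
  rw [hV.bellman]
  fin_cases a
  exacts [min_le_left _ _, min_le_right _ _]

theorem Q_greedy (hV : S.IsRelativeValue g V) {π : S.Stationary} (hπ : S.IsGreedy V π)
    (x : S.State) : S.Q V x (π x) = g + V x :=
  le_antisymm (by rw [hV.bellman]; exact le_min (hπ x 0) (hπ x 1)) (hV.le_Q x _)

/-- Every slot costs at least `1`, so the Bellman equation gives `V ≥ 1 + inf V - g` everywhere;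
take the infimum. Nonnegativity of `g` is needed to move it into `[0, ∞]`. -/
theorem one_le_gain (hV : S.IsRelativeValue g V) : 1 ≤ g := by
  have hb := hV.bddBelow
  have hlow : ∀ x a, 1 + ⨅ x, V x ≤ S.Q V x a := by
    intro x a
    have h1 : (1 : ℝ) ≤ ((x.1 : ℕ) : ℝ) := by exact_mod_cast x.1.pos
    have h2 := age_le_cost x a
    have h3 : ∀ x, ⨅ x, V x ≤ V x := ciInf_le hb
    unfold Q
    rw [(hasSum_transition V x a).tsum_eq]
    exact add_le_add (h1.trans h2) (le_mix S.lam_nonneg S.lam_le_one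
      (le_mix S.p_pos.le S.p_lt_one.le (h3 _) (h3 _))
      (le_mix S.p_pos.le S.p_lt_one.le (h3 _) (h3 _)))
  have : 1 + (⨅ x, V x) - g ≤ ⨅ x, V x := le_ciInf fun x => by
    have := hV.bellman x
    have := le_min (hlow x 0) (hlow x 1)
    linarith
  linarith

/-- The Bellman operator on a nonnegative translate of `V`, in `[0, ∞]`. -/
theorem cost_add_mean {k : ℝ} (hk : ∀ x, 0 ≤ V x + k) (x : S.State) (a : Action) :
    ENNReal.ofReal (S.cost x a) + (S.transition x a).mean (fun x => ENNReal.ofReal (V x + k)) =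
      ENNReal.ofReal (S.Q V x a + k) := by
  have hs := hasSum_transition (fun x => V x + k) x a
  rw [PMF.mean_ofReal _ hk hs, ← ENNReal.ofReal_add]
  · congr 1
    unfold Q
    rw [(hasSum_transition V x a).tsum_eq]
    ring
  · exact (Nat.cast_nonneg _).trans (age_le_cost x a)
  · exact hs.nonneg fun x => mul_nonneg ENNReal.toReal_nonneg (hk x)

theorem exists_shift (hV : S.IsRelativeValue g V) : ∃ k, ∀ x, 0 ≤ V x + k := by
  obtain ⟨k, hk⟩ := hV.bddBelow
  exact ⟨-k, fun x => by linarith [hk ⟨x, rfl⟩]⟩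

theorem le_avgCost (hV : S.IsRelativeValue g V) (σ : S.Policy) (x₀ : S.State) :
    ENNReal.ofReal g ≤ S.avgCost σ x₀ := by
  obtain ⟨k, hk⟩ := hV.exists_shift
  obtain ⟨H, hH⟩ := hV.isAgeSolution.exists_upper
  have hg := hV.one_le_gain
  have hb : ∀ x a, ENNReal.ofReal g + ENNReal.ofReal (V x + k) ≤
      ENNReal.ofReal (S.cost x a) +
        (S.transition x a).mean (fun x => ENNReal.ofReal (V x + k)) := by
    intro x a
    rw [cost_add_mean hk, ← ENNReal.ofReal_add (by linarith) (hk x)]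
    exact ENNReal.ofReal_le_ofReal (by linarith [hV.le_Q x a])
  set K : ℝ := (1 - S.p)⁻¹ + |H| + |k|
  have hK : 0 ≤ K := by have := S.inv_one_sub_p_pos; positivity
  -- The value grows linearly in the age and the cost is at least the age, so the terminal term is
  -- at most `K` times the expected cost of slot `T`.
  have hw : ∀ x a, ENNReal.ofReal (V x + k) ≤ ENNReal.ofReal K * ENNReal.ofReal (S.cost x a) := by
    intro x a
    rw [← ENNReal.ofReal_mul hK]
    refine ENNReal.ofReal_le_ofReal (le_trans ?_ (mul_le_mul_of_nonneg_left (age_le_cost x a) hK))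
    have h1 := hH x.1.natPred x.2
    have h2 : ((x.1.natPred : ℕ) : ℝ) + 1 = ((x.1 : ℕ) : ℝ) := by
      exact_mod_cast PNat.natPred_add_one x.1
    rw [coord_apply, PNat.succPNat_natPred, h2] at h1
    have h3 : (1 : ℝ) ≤ ((x.1 : ℕ) : ℝ) := by exact_mod_cast x.1.pos
    have h4 := mul_le_mul_of_nonneg_left h3 (abs_nonneg H)
    have h5 := mul_le_mul_of_nonneg_left h3 (abs_nonneg k)
    have h6 : K * ((x.1 : ℕ) : ℝ) = (1 - S.p)⁻¹ * ((x.1 : ℕ) : ℝ) + |H| * ((x.1 : ℕ) : ℝ) +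
      |k| * ((x.1 : ℕ) : ℝ) := by ring
    linarith [le_abs_self H, le_abs_self k]
  refine le_limsup_average (K := K) fun T => (telescope_le σ x₀ hb T).trans ?_
  gcongr
  rw [expectedCost_eq_mean, ← PMF.mean_const_mul]
  refine PMF.mean_mono _ fun y => ?_
  rw [← PMF.mean_const_mul]
  calc ENNReal.ofReal (V y.2 + k) = (σ y.1 y.2).mean fun _ => ENNReal.ofReal (V y.2 + k) :=
        (PMF.mean_const _ _).symm
    _ ≤ _ := PMF.mean_mono _ fun a => hw y.2 a

theorem avgCost_greedy_le (hV : S.IsRelativeValue g V) {π : S.Stationary} (hπ : S.IsGreedy V π)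
    (x₀ : S.State) : S.avgCost π.toPolicy x₀ ≤ ENNReal.ofReal g := by
  obtain ⟨k, hk⟩ := hV.exists_shift
  have hg := hV.one_le_gain
  refine limsup_average_le (c := ENNReal.ofReal (V x₀ + k))
    ENNReal.ofReal_ne_top fun T => le_trans le_self_add
      (le_telescope π x₀ (w := fun x => ENNReal.ofReal (V x + k)) (fun x => ?_) T)
  rw [cost_add_mean hk, hV.Q_greedy hπ, ← ENNReal.ofReal_add (by linarith) (hk x), add_assoc]

theorem isOptimal_of_isGreedy (hV : S.IsRelativeValue g V) {π : S.Stationary}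
    (hπ : S.IsGreedy V π) : S.IsOptimal π := fun x₀ σ =>
  (hV.avgCost_greedy_le hπ x₀).trans (hV.le_avgCost σ x₀)

end IsRelativeValue

theorem exists_isGreedy (S : UpdateSystem) (V : S.State → ℝ) : ∃ π, S.IsGreedy V π := by
  choose π hπ using fun x => Finite.exists_min (S.Q V x)
  exact ⟨π, hπ⟩

theorem IsRelativeValue.iInf_avgCost {g : ℝ} {V : S.State → ℝ} (hV : S.IsRelativeValue g V)
    (x₀ : S.State) : (⨅ σ : S.Policy, S.avgCost σ x₀) = ENNReal.ofReal g := by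
  obtain ⟨π, hπ⟩ := S.exists_isGreedy V
  exact le_antisymm ((iInf_le _ π.toPolicy).trans (hV.avgCost_greedy_le hπ x₀))
    (le_iInf fun σ => hV.le_avgCost σ x₀)

/-- The threshold is the first age at which `π` transmits. There transmitting is weakly better,
hence strictly better at all later ages by strict submodularity, so ties cannot break the pattern.
-/
theorem IsRelativeValue.threshold {g : ℝ} {V : S.State → ℝ} (hV : S.IsRelativeValue g V)
    {π : S.Stationary} (hπ : S.IsGreedy V π) (q : Fin (S.B + 1)) :
    ∃ Δq : ℕ+, ∀ Δ : ℕ+, (Δ < Δq → π (Δ, q) = 0) ∧ (Δq ≤ Δ → π (Δ, q) = 1) := by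
  have hv := hV.isAgeSolution
  obtain ⟨D, hD⟩ := hv.exists_send_lt_idle
  have hne : ∀ a : Action, a ≠ 1 → a = 0 := by decide
  have hlt : ∀ d : ℕ, S.sendValue 1 (coord V) d q < S.idleValue 1 (coord V) d q →
      π (d.succPNat, q) = 1 := by
    intro d h
    rw [← Q_zero, ← Q_one] at h
    by_contra hπ1
    have h0 := hne _ hπ1
    have := hπ (d.succPNat, q) 1
    rw [h0] at this
    exact absurd h (not_lt.2 this)
  have hex : ∃ d : ℕ, π (d.succPNat, q) = 1 := ⟨D, hlt D (hD D le_rfl q)⟩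
  classical
  refine ⟨(Nat.find hex).succPNat, fun Δ => ?_⟩
  obtain ⟨d, rfl⟩ : ∃ d : ℕ, Δ = d.succPNat := ⟨Δ.natPred, (PNat.succPNat_natPred Δ).symm⟩
  rw [Nat.succPNat_lt_succPNat, Nat.succPNat_le_succPNat]
  refine ⟨fun h => ?_, fun h => ?_⟩
  · exact hne _ (Nat.find_min hex h)
  · rcases h.eq_or_lt with h | h
    · rw [← h]; exact Nat.find_spec hex
    · refine hlt d ?_
      have h0 : S.sendValue 1 (coord V) (Nat.find hex) q ≤
          S.idleValue 1 (coord V) (Nat.find hex) q := by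
        have := hπ ((Nat.find hex).succPNat, q) 0
        rwa [Nat.find_spec hex, Q_zero, Q_one] at this
      have hp := S.p_lt_one
      have hm : StrictMono fun d =>
          S.idleValue 1 (coord V) d q - S.sendValue 1 (coord V) d q :=
        strictMono_nat_of_lt_succ fun d => by linarith [hv.submodular d q]
      have := hm h
      simp only at this
      linarith

end

end UpdateSystem

theorem theorem1 (S : UpdateSystem) :
    -- a relative value function exists
    (∃ (g : ℝ) (V : S.State → ℝ), S.IsRelativeValue g V) ∧
    ∀ (g : ℝ) (V : S.State → ℝ), S.IsRelativeValue g V →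
      -- the gain is the optimal average cost, from every initial state
      (∀ x₀ : S.State, (⨅ σ : S.Policy, S.avgCost σ x₀) = ENNReal.ofReal g) ∧
      -- every policy that minimizes the state-action value function is optimal and of threshold type
      (∀ π : S.Stationary, S.IsGreedy V π →
        S.IsOptimal π ∧
        ∀ q : Fin (S.B + 1), ∃ Δq : ℕ+, ∀ Δ : ℕ+,
          (Δ < Δq → π (Δ, q) = 0) ∧ (Δq ≤ Δ → π (Δ, q) = 1)) ∧
      -- submodularity of the state-action value function in (age, action)
      (∀ (Δ : ℕ+) (q : Fin (S.B + 1)),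
        S.Q V (Δ, q) 0 - S.Q V (Δ, q) 1 ≤ S.Q V (Δ + 1, q) 0 - S.Q V (Δ + 1, q) 1) ∧
      -- monotonicity in the age
      (∀ (Δ₁ Δ₂ : ℕ+) (q : Fin (S.B + 1)), Δ₁ ≤ Δ₂ → V (Δ₁, q) ≤ V (Δ₂, q)) ∧
      -- monotonicity in the battery level
      (S.lam < 1 → ∀ (Δ : ℕ+) (q : Fin S.B), V (Δ, q.succ) ≤ V (Δ, q.castSucc)) ∧
      -- increments in the age
      (∀ (Δ₁ Δ₂ : ℕ+) (q : Fin (S.B + 1)), Δ₁ ≤ Δ₂ →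
        ((Δ₂ : ℕ) : ℝ) - ((Δ₁ : ℕ) : ℝ) ≤ V (Δ₂, q) - V (Δ₁, q)) ∧
      (∀ (Δ : ℕ+) (q : Fin S.B),
        S.p * (V (Δ + 1, q.castSucc) - V (Δ, q.castSucc)) ≤
          V (Δ + 1, q.succ) - V (Δ, q.succ)) := by
  refine ⟨S.exists_isRelativeValue, fun g V hV => ?_⟩
  have hv := hV.isAgeSolution
  have hp := S.p_lt_one
  have surj : ∀ Δ : ℕ+, ∃ d : ℕ, Δ = d.succPNat :=
    fun Δ => ⟨Δ.natPred, (PNat.succPNat_natPred Δ).symm⟩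
  have succ : ∀ d : ℕ, d.succPNat + 1 = (d + 1).succPNat := fun d => rfl
  have incr : ∀ (Δ₁ Δ₂ : ℕ+) (q : Fin (S.B + 1)), Δ₁ ≤ Δ₂ →
      ((Δ₂ : ℕ) : ℝ) - ((Δ₁ : ℕ) : ℝ) ≤ V (Δ₂, q) - V (Δ₁, q) := by
    intro Δ₁ Δ₂ q h
    obtain ⟨d₁, rfl⟩ := surj Δ₁
    obtain ⟨d₂, rfl⟩ := surj Δ₂
    rw [Nat.succPNat_le_succPNat] at h
    have hm : Monotone fun d : ℕ => UpdateSystem.coord V d q - (d : ℝ) :=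
      monotone_nat_of_le_succ fun d => by
        have := (hv.increments d).1 q
        push_cast
        linarith
    have := hm h
    simp only [UpdateSystem.coord_apply] at this
    simp only [Nat.succPNat_coe, Nat.cast_succ]
    linarith
  refine ⟨hV.iInf_avgCost, fun π hπ => ⟨hV.isOptimal_of_isGreedy hπ, hV.threshold hπ⟩,
    fun Δ q => ?_, fun Δ₁ Δ₂ q h => ?_, fun hlam Δ q => ?_, incr, fun Δ q => ?_⟩
  · obtain ⟨d, rfl⟩ := surj Δ
    rw [succ, UpdateSystem.Q_zero, UpdateSystem.Q_one, UpdateSystem.Q_zero, UpdateSystem.Q_one]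
    linarith [hv.submodular d q]
  · have h1 := incr Δ₁ Δ₂ q h
    have h2 : ((Δ₁ : ℕ) : ℝ) ≤ ((Δ₂ : ℕ) : ℝ) := by exact_mod_cast h
    linarith
  · obtain ⟨d, rfl⟩ := surj Δ
    rw [← UpdateSystem.coord_apply V, ← UpdateSystem.coord_apply V]
    simpa using hv.battery_antitone hlam d q
  · obtain ⟨d, rfl⟩ := surj Δ
    have h := (hv.increments d).2 q
    rw [succ, ← UpdateSystem.coord_apply V, ← UpdateSystem.coord_apply V, ← UpdateSystem.coord_apply V,
      ← UpdateSystem.coord_apply V]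
    simp only [Fin.val_castSucc, Fin.val_succ]
    linarith
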